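/- Let $a\ge 1$, let $\Omega=\{x^2/a^2+a^2y^2<1\}$, with area $A=\pi$, perimeter $P$, eccentricity $e=\sqrt{1-a^{-4}}$, and boundary moments $i_{2k}=\int_{\partial\Omega}(x^2+y^2)^k\,ds$. Let $E(k)=\int_0^{\pi/2}\sqrt{1-k^2\sin^2\theta}\,d\theta$ and $K(k)=\int_0^{\pi/2}(1-k^2\sin^2\theta)^{-1/2}\,d\theta$. Put $$\mathcal A(v)=\int_\Omega(2v-|\nabla v|^2),\qquad \mathcal B(v)=\int_{\partial\Omega}v^2\,ds,\qquad \mathcal J(v)=\mathcal A(v)-\tfrac1\beta\,\mathcal B(v)\quad(\beta>0),$$ $$u_0=\frac{1-x^2/a^2-a^2y^2}{2(a^{-2}+a^2)},\quad Q_0=\int_\Omega u_0,\quad C_1=\int_{\partial\Omega}(x^2-y^2)\,ds,\quad C_2=\int_{\partial\Omega}(x^2-y^2)^2\,ds,$$ $$v_t=u_0+t\left(x^2-y^2-\frac{C_1}{P}\right),\qquad t_*=\frac{-1+a^4-4a^2C_1/P}{4(1+a^4)},\qquad v_*=v_{t_*},$$ $$\Sigma_{a,\infty}=\int_\Omega v_*,\qquad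 \Sigma_{a,1}=-\int_{\partial\Omega}v_*^2\,ds,\qquad R_a(\beta)=Q_0+\beta\frac{A^2}{P}+\frac{\beta(\Sigma_{a,\infty}-Q_0)^2}{\beta(\Sigma_{a,\infty}-Q_0)-\Sigma_{a,1}},$$ where the last fraction is read as $0$ if $a=1$ (its numerator and denominator then both vanish). Solutions of boundary value problems below are classical, in $C^2(\Omega)\cap C^1(\overline\Omega)$, and $\partial/\partial n$ is the outward normal derivative. Then the following hold. 1. $P=4aE(e)$, $\;i_2=\frac{4}{3a}\left((1+a^4)E(e)+K(e)\right)$, $\;i_4=\frac{4}{5a^3}\left((1-a^4+a^8)E(e)+2(1+a^4)K(e)\right)$, and for $a>1$ $$C_1=\frac{-2a^2P+(1+a^4)i_2}{-1+a^4},\qquad C_2=\frac{4a^4P-4a^2(1+a^4)i_2+(1+a^4)^2i_4}{(-1+a^4)^2}.$$ 2. $-\Delta u_0=1$ in $\Omega$, $u_0=0$ on $\partial\Omega$, and $Q_0=\dfrac{\pi a^2}{4(1+a^4)}$. 3. For every $t$, $\int_{\partial\Omega}v_t\,ds=0$, $\;\mathcal B(v_t)=t^2(C_2-C_1^2/P)$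 and $$\mathcal A(v_t)=-\frac{\pi\left(4(1+a^4)^2t^2-2(1+a^4)(-1+a^4-4a^2C_1/P)\,t-a^4\right)}{4a^2(1+a^4)};$$ $t_*$ is the unique maximiser of $t\mapsto\mathcal A(v_t)$. 4. $$\Sigma_{a,\infty}=\mathcal A(v_*)=\int_\Omega|\nabla v_*|^2=\frac{\pi\left(a^4+\frac14(-1+a^4-4a^2C_1/P)^2\right)}{4a^2(1+a^4)},$$ $$\Sigma_{a,1}=-\frac{(-4a^2C_1/P+a^4-1)^2\,(C_2-C_1^2/P)}{16(a^4+1)^2}.$$ 5. Let $\beta>0$. If $a>1$, the denominator $\beta(\Sigma_{a,\infty}-Q_0)-\Sigma_{a,1}$ is positive. Among the quadratics $c+c_{xx}x^2+c_{yy}y^2$ with real $c,c_{xx},c_{yy}$ there is exactly one, $v_{\rm quad,max}$, that maximises $\mathcal J$, and $\mathcal J(v_{\rm quad,max})=R_a(\beta)$. Moreover $R_a(\beta)\le Q(\beta)=\int_\Omega u$ whenever $u$ solves $-\Delta u=1$ in $\Omega$, $u+\beta\,\partial u/\partial n=0$ on $\partial\Omega$. 6. If $u_\infty$ solves $-\Delta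 u_\infty=1$ in $\Omega$, $\partial u_\infty/\partial n=-A/P$ on $\partial\Omega$, $\int_{\partial\Omega}u_\infty\,ds=0$, and $\Sigma_\infty=\int_\Omega u_\infty$, then $\Sigma_{a,\infty}\le\Sigma_\infty$, with strict inequality if $a>1$. -/

import Mathlib

open MeasureTheory Set

namespace EllipseSlip

/-! ### The ellipse `x² / a² + a² y² < 1`, its boundary and boundary integrals -/

/-- The open elliptical domain `Ω`. -/
def ellipse (a : ℝ) : Set (ℝ × ℝ) := {p | p.1 ^ 2 / a ^ 2 + a ^ 2 * p.2 ^ 2 < 1}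

/-- The closure of `Ω`. -/
def closedEllipse (a : ℝ) : Set (ℝ × ℝ) := {p | p.1 ^ 2 / a ^ 2 + a ^ 2 * p.2 ^ 2 ≤ 1}

/-- The usual parametrisation of `∂Ω`, with `ψ ∈ [0, 2π]`. -/
noncomputable def bdry (a ψ : ℝ) : ℝ × ℝ := (a * Real.cos ψ, Real.sin ψ / a)

/-- `ds / dψ`, the Euclidean length of the derivative of the parametrisation. -/
noncomputable def speed (a ψ : ℝ) : ℝ :=
  Real.sqrt (a ^ 2 * Real.sin ψ ^ 2 + Real.cos ψ ^ 2 / a ^ 2)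

/-- The outward unit normal at the boundary point with parameter `ψ`. -/
noncomputable def normal (a ψ : ℝ) : ℝ × ℝ :=
  (Real.cos ψ / a / speed a ψ, a * Real.sin ψ / speed a ψ)

/-- `∫_{∂Ω} f ds`, the integral with respect to arc length. -/
noncomputable def bdryIntegral (a : ℝ) (f : ℝ × ℝ → ℝ) : ℝ :=
  ∫ ψ in (0 : ℝ)..(2 * Real.pi), f (bdry a ψ) * speed a ψ

/-- The area `A = |Ω|`. -/
noncomputable def area (a : ℝ) : ℝ := (volume (ellipse a)).toReal

/-- The perimeter `P = |∂Ω|`. -/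
noncomputable def perimeter (a : ℝ) : ℝ := bdryIntegral a (fun _ => 1)

/-- The boundary moment `i_{2k} = ∫_{∂Ω} (x² + y²)^k ds`. -/
noncomputable def bdryMoment (k : ℕ) (a : ℝ) : ℝ :=
  bdryIntegral a (fun p => (p.1 ^ 2 + p.2 ^ 2) ^ k)

/-- `C₁ = ∫_{∂Ω} (x² - y²) ds`. -/
noncomputable def momentC1 (a : ℝ) : ℝ := bdryIntegral a (fun p => p.1 ^ 2 - p.2 ^ 2)

/-- `C₂ = ∫_{∂Ω} (x² - y²)² ds`. -/
noncomputable def momentC2 (a : ℝ) : ℝ := bdryIntegral a (fun p => (p.1 ^ 2 - p.2 ^ 2) ^ 2)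

/-- The eccentricity `e`. -/
noncomputable def ecc (a : ℝ) : ℝ := Real.sqrt (1 - 1 / a ^ 4)

/-- The complete elliptic integral of the second kind, as a function of the modulus. -/
noncomputable def ellipticE (k : ℝ) : ℝ :=
  ∫ θ in (0 : ℝ)..(Real.pi / 2), Real.sqrt (1 - k ^ 2 * Real.sin θ ^ 2)

/-- The complete elliptic integral of the first kind, as a function of the modulus. -/
noncomputable def ellipticK (k : ℝ) : ℝ :=
  ∫ θ in (0 : ℝ)..(Real.pi / 2), 1 / Real.sqrt (1 - k ^ 2 * Real.sin θ ^ 2)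

/-! ### Differential operators and the functionals -/

/-- `∂v/∂x`. -/
noncomputable def dx (v : ℝ × ℝ → ℝ) (p : ℝ × ℝ) : ℝ := fderiv ℝ v p (1, 0)

/-- `∂v/∂y`. -/
noncomputable def dy (v : ℝ × ℝ → ℝ) (p : ℝ × ℝ) : ℝ := fderiv ℝ v p (0, 1)

/-- `∂²v/∂x² + ∂²v/∂y²`. -/
noncomputable def laplacian (v : ℝ × ℝ → ℝ) (p : ℝ × ℝ) : ℝ :=
  dx (dx v) p + dy (dy v) p

/-- `|∇v|²`. -/
noncomputable def gradSq (v : ℝ × ℝ → ℝ) (p : ℝ × ℝ) : ℝ := dx v p ^ 2 + dy v p ^ 2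

/-- `𝒜(v) = ∫_Ω (2 v - |∇v|²)`. -/
noncomputable def functionalA (a : ℝ) (v : ℝ × ℝ → ℝ) : ℝ :=
  ∫ p in ellipse a, (2 * v p - gradSq v p)

/-- `ℬ(v) = ∫_{∂Ω} v²`. -/
noncomputable def functionalB (a : ℝ) (v : ℝ × ℝ → ℝ) : ℝ :=
  bdryIntegral a (fun p => v p ^ 2)

/-- `𝒥(v) = 𝒜(v) - ℬ(v) / β`. -/
noncomputable def functionalJ (a β : ℝ) (v : ℝ × ℝ → ℝ) : ℝ :=
  functionalA a v - 1 / β * functionalB a v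

/-! ### The boundary value problems -/

/-- `u ∈ C²(Ω) ∩ C¹(closure of Ω)`, where `g` is the continuous extension of `∇u` to the
closure. -/
structure IsC2C1 (a : ℝ) (u : ℝ × ℝ → ℝ) (g : ℝ × ℝ → ℝ × ℝ) : Prop where
  contDiffOn : ContDiffOn ℝ 2 u (ellipse a)
  continuousOn : ContinuousOn u (closedEllipse a)
  grad_continuousOn : ContinuousOn g (closedEllipse a)
  grad_eq : ∀ p ∈ ellipse a, g p = (dx u p, dy u p)

/-- The outward normal component, at the boundary point with parameter `ψ`, of a vector field. -/
noncomputable def normalComp (a : ℝ) (g : ℝ × ℝ → ℝ × ℝ) (ψ : ℝ) : ℝ :=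
  (g (bdry a ψ)).1 * (normal a ψ).1 + (g (bdry a ψ)).2 * (normal a ψ).2

/-- `u` is a classical solution of `-Δu = 1` in `Ω`, `u + β ∂u/∂n = 0` on `∂Ω`.
With `β = 0` this is the torsion problem. -/
def SolvesSlip (a β : ℝ) (u : ℝ × ℝ → ℝ) : Prop :=
  ∃ g : ℝ × ℝ → ℝ × ℝ, IsC2C1 a u g ∧
    (∀ p ∈ ellipse a, -laplacian u p = 1) ∧
    ∀ ψ : ℝ, u (bdry a ψ) + β * normalComp a g ψ = 0

/-- `u` is a classical solution of `-Δu = 1` in `Ω`, `∂u/∂n = -|Ω| / |∂Ω|` on `∂Ω`,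
`∫_{∂Ω} u = 0`. -/
def SolvesInfinity (a : ℝ) (u : ℝ × ℝ → ℝ) : Prop :=
  ∃ g : ℝ × ℝ → ℝ × ℝ, IsC2C1 a u g ∧
    (∀ p ∈ ellipse a, -laplacian u p = 1) ∧
    (∀ ψ : ℝ, normalComp a g ψ = -(area a / perimeter a)) ∧
    bdryIntegral a u = 0

/-! ### Test functions, approximations and the lower bound -/

/-- The torsion function `u₀` of the ellipse. -/
noncomputable def u0 (a : ℝ) (p : ℝ × ℝ) : ℝ :=
  (1 - p.1 ^ 2 / a ^ 2 - a ^ 2 * p.2 ^ 2) / (2 * (1 / a ^ 2 + a ^ 2))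

/-- The torsional rigidity `Q₀ = ∫_Ω u₀`. -/
noncomputable def torsionalRigidity (a : ℝ) : ℝ := ∫ p in ellipse a, u0 a p

/-- The test function `u₀ + t (x² - y² - C₁ / P)`. -/
noncomputable def testFun (a t : ℝ) (p : ℝ × ℝ) : ℝ :=
  u0 a p + t * (p.1 ^ 2 - p.2 ^ 2 - momentC1 a / perimeter a)

/-- The optimal parameter `t_*`. -/
noncomputable def tStar (a : ℝ) : ℝ :=
  (-1 + a ^ 4 - 4 * a ^ 2 * (momentC1 a / perimeter a)) / (4 * (1 + a ^ 4))

/-- The test function `v_*` with the optimal parameter. -/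
noncomputable def vStar (a : ℝ) : ℝ × ℝ → ℝ := testFun a (tStar a)

/-- `Σ_{a,∞} = ∫_Ω v_*`. -/
noncomputable def sigmaAInf (a : ℝ) : ℝ := ∫ p in ellipse a, vStar a p

/-- `Σ_{a,1} = -∫_{∂Ω} v_*²`. -/
noncomputable def sigmaAOne (a : ℝ) : ℝ := -bdryIntegral a (fun p => vStar a p ^ 2)

/-- The rational function
`R = Q₀ + β A² / P + β (Σ_∞ - Q₀)² / (β (Σ_∞ - Q₀) - Σ₁)`. -/
noncomputable def boundR (A P Sinf S1 Q0 β : ℝ) : ℝ :=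
  Q0 + β * (A ^ 2 / P) + β * (Sinf - Q0) ^ 2 / (β * (Sinf - Q0) - S1)

/-- `R_a(β)`: `Σ_∞`, `Σ₁` are replaced by `Σ_{a,∞}`, `Σ_{a,1}`. For `a = 1` numerator and
denominator of the last term of `R` vanish, and that term is then `0`. -/
noncomputable def boundRa (a β : ℝ) : ℝ :=
  boundR (area a) (perimeter a) (sigmaAInf a) (sigmaAOne a) (torsionalRigidity a) β

/-- The quadratic `c + c_xx x² + c_yy y²`, with `q = (c, c_xx, c_yy)`. -/
def vQuad (q : ℝ × ℝ × ℝ) (p : ℝ × ℝ) : ℝ := q.1 + q.2.1 * p.1 ^ 2 + q.2.2 * p.2 ^ 2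

/-- `vQuad q` maximises `𝒥` among the quadratics. -/
def IsBestQuad (a β : ℝ) (q : ℝ × ℝ × ℝ) : Prop :=
  ∀ q' : ℝ × ℝ × ℝ, functionalJ a β (vQuad q') ≤ functionalJ a β (vQuad q)

end EllipseSlip

open MeasureTheory Set

namespace EllipseSlip

variable {a : ℝ}

/-! The bounds rest on one identity. If $-\Delta u=1$, expanding the square and applying Green's
formula gives $\mathcal A(v)+\int_\Omega|\nabla(v-u)|^2=\int_\Omega u+\oint u\,\partial_n u-2\oint
v\,\partial_n u$ (`energy_identity`). Under the slip condition the boundary terms together with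
$-\mathcal B(v)/\beta$ complete to $-\frac1\beta\oint(u-v)^2$, so $\mathcal J(v)\le\int_\Omega u$.
In the limiting Neumann problem $\partial_n u$ is constant, and the boundary terms vanish when $u$
and $v$ have zero boundary mean; then $\mathcal A(v)\le\int_\Omega u$, and equality forces $\nabla
v=\nabla u$ up to the boundary. For $v_*$ this would make a quadratic have constant nonzero normal
derivative, which happens only on a disk.

On quadratics everything is explicit. In the basis $u_0$, $x^2-y^2-C_1/P$, $1$ the functional
$\mathcal J$ is diagonal: $u_0$ vanishes on $\partial\Omega$, $x^2-y^2$ is harmonic, and the second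
function has zero boundary mean. Completing three squares (`functionalJ_quadOf`) gives the unique
maximiser and the value $R_a(\beta)$.

The positive denominator needs $t_*\ne0$, that is, a boundary mean of $x^2-y^2$ different from its
interior mean. The boundary moments are integrals of powers of $s=ds/d\psi$; a recurrence between
these reduces the moments to $\oint ds$ and $\int d\psi/s$, hence to $E$ and $K$, and pointwise
bounds on $s$ and $1/s$ then settle the sign of $t_*$ (`mean_lt_boundary_mean`). -/

lemma isOpen_ellipse (a : ℝ) : IsOpen (ellipse a) :=
  isOpen_lt (by fun_prop) continuous_const

lemma isCompact_closedEllipse (ha : 0 < a) : IsCompact (closedEllipse a) := by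
  refine (isCompact_Icc (a := ((-a, -(1 / a)) : ℝ × ℝ)) (b := (a, 1 / a))).of_isClosed_subset
    (isClosed_le (by fun_prop) continuous_const) ?_
  rintro ⟨x, y⟩ h
  have h : x ^ 2 / a ^ 2 + a ^ 2 * y ^ 2 ≤ 1 := h
  have hx : (x / a) ^ 2 ≤ 1 := by
    rw [div_pow]
    nlinarith [sq_nonneg (a * y)]
  have hy : (a * y) ^ 2 ≤ 1 := by
    have : 0 ≤ x ^ 2 / a ^ 2 := by positivity
    nlinarith
  obtain ⟨h1, h2⟩ := abs_le.mp ((sq_le_one_iff_abs_le_one _).mp hx)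
  obtain ⟨h3, h4⟩ := abs_le.mp ((sq_le_one_iff_abs_le_one _).mp hy)
  rw [le_div_iff₀ ha] at h1
  rw [div_le_iff₀ ha] at h2
  refine ⟨⟨by simpa using h1, ?_⟩, ⟨by simpa using h2, ?_⟩⟩
  · change -(1 / a) ≤ y
    rw [← neg_div, div_le_iff₀ ha]
    linarith
  · change y ≤ 1 / a
    rw [le_div_iff₀ ha]
    linarith

lemma ellipse_subset_closedEllipse (a : ℝ) : ellipse a ⊆ closedEllipse a :=
  fun _ h => le_of_lt (show _ < (1 : ℝ) from h)

lemma integrableOn_ellipse (ha : 0 < a) {f : ℝ × ℝ → ℝ} (hf : ContinuousOn f (closedEllipse a)) :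
    IntegrableOn f (ellipse a) :=
  (hf.integrableOn_compact (isCompact_closedEllipse ha)).mono_set (ellipse_subset_closedEllipse a)

/-! ### Elliptical polar coordinates and the divergence theorem -/

/-- Elliptical polar coordinates. -/
noncomputable def ellPolar (a : ℝ) (q : ℝ × ℝ) : ℝ × ℝ :=
  (a * (q.1 * Real.cos q.2), q.1 * Real.sin q.2 / a)

lemma continuous_ellPolar (a : ℝ) : Continuous (ellPolar a) := by
  unfold ellPolar
  fun_prop

lemma ellPolar_one (a ψ : ℝ) : ellPolar a (1, ψ) = bdry a ψ := by
  simp [ellPolar, bdry]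

lemma ellPolar_norm (ha : 0 < a) (q : ℝ × ℝ) :
    (ellPolar a q).1 ^ 2 / a ^ 2 + a ^ 2 * (ellPolar a q).2 ^ 2 = q.1 ^ 2 := by
  have h : (ellPolar a q).1 ^ 2 / a ^ 2 + a ^ 2 * (ellPolar a q).2 ^ 2
      = q.1 ^ 2 * (Real.sin q.2 ^ 2 + Real.cos q.2 ^ 2) := by
    simp only [ellPolar]
    field_simp
    ring
  rw [h, Real.sin_sq_add_cos_sq, mul_one]

lemma ellPolar_mem_ellipse (ha : 0 < a) {q : ℝ × ℝ} (h0 : 0 ≤ q.1) :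
    ellPolar a q ∈ ellipse a ↔ q.1 < 1 := by
  change (ellPolar a q).1 ^ 2 / a ^ 2 + a ^ 2 * (ellPolar a q).2 ^ 2 < 1 ↔ _
  rw [ellPolar_norm ha, sq_lt_one_iff₀ h0]

lemma ellPolar_mem_closedEllipse (ha : 0 < a) {q : ℝ × ℝ} (h0 : 0 ≤ q.1) (h1 : q.1 ≤ 1) :
    ellPolar a q ∈ closedEllipse a := by
  change (ellPolar a q).1 ^ 2 / a ^ 2 + a ^ 2 * (ellPolar a q).2 ^ 2 ≤ 1
  rw [ellPolar_norm ha, sq_le_one_iff₀ h0]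
  exact h1

lemma bdry_mem_closedEllipse (ha : 0 < a) (ψ : ℝ) : bdry a ψ ∈ closedEllipse a := by
  rw [← ellPolar_one]
  exact ellPolar_mem_closedEllipse ha zero_le_one le_rfl

lemma continuous_bdry (a : ℝ) : Continuous (bdry a) := by
  unfold bdry
  fun_prop

/-- The area-preserving linear map taking the unit disk to the ellipse. -/
noncomputable def ellScale (a : ℝ) : ℝ × ℝ →L[ℝ] ℝ × ℝ :=
  (Matrix.toLin (.finTwoProd ℝ) (.finTwoProd ℝ) !![a, 0; 0, 1 / a]).toContinuousLinearMap

lemma ellScale_apply (a : ℝ) (q : ℝ × ℝ) : ellScale a q = (a * q.1, q.2 / a) := by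
  simp [ellScale, Matrix.toLin_finTwoProd_apply, div_eq_inv_mul]

lemma det_ellScale (ha : 0 < a) : (ellScale a).det = 1 := by
  unfold ellScale
  simp only [LinearMap.det_toContinuousLinearMap, LinearMap.det_toLin, Matrix.det_fin_two_of]
  field_simp
  ring

/-- The scaling has determinant 1, so the Jacobian is that of ordinary polar coordinates. -/
lemma integral_comp_ellPolar (ha : 0 < a) (f : ℝ × ℝ → ℝ) :
    ∫ q in Ioi (0 : ℝ) ×ˢ Ioo (-Real.pi) Real.pi, q.1 * f (ellPolar a q) = ∫ p, f p := by
  have hinj : InjOn (ellScale a) univ := by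
    intro p _ q _ h
    simp only [ellScale_apply, Prod.mk.injEq] at h
    obtain ⟨h1, h2⟩ := h
    rw [div_left_inj' ha.ne'] at h2
    exact Prod.ext (mul_left_cancel₀ ha.ne' h1) h2
  have himage : ellScale a '' univ = univ := by
    refine eq_univ_of_forall fun p => ⟨(p.1 / a, p.2 * a), mem_univ _, ?_⟩
    rw [ellScale_apply]
    ext
    · field_simp
    · field_simp
  have h := integral_image_eq_integral_abs_det_fderiv_smul volume MeasurableSet.univ
    (fun x _ => (ellScale a).hasFDerivAt.hasFDerivWithinAt) hinj f
  rw [himage] at h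
  simp only [det_ellScale ha, abs_one, one_smul, setIntegral_univ] at h
  rw [h, ← integral_comp_polarCoord_symm (fun x => f (ellScale a x))]
  simp only [polarCoord_target, polarCoord_symm_apply, ellScale_apply, smul_eq_mul, ellPolar]

lemma setIntegral_ellipse (ha : 0 < a) (f : ℝ × ℝ → ℝ) :
    ∫ p in ellipse a, f p
      = ∫ q in Ioo (0 : ℝ) 1 ×ˢ Ioo (-Real.pi) Real.pi, q.1 * f (ellPolar a q) := by
  have hm : MeasurableSet (Iio (1 : ℝ) ×ˢ (univ : Set ℝ)) := measurableSet_Iio.prod .univ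
  have hset : (Iio (1 : ℝ) ×ˢ (univ : Set ℝ)) ∩ (Ioi (0 : ℝ) ×ˢ Ioo (-Real.pi) Real.pi)
      = Ioo (0 : ℝ) 1 ×ˢ Ioo (-Real.pi) Real.pi := by
    rw [prod_inter_prod, univ_inter, inter_comm, Ioi_inter_Iio]
  rw [← integral_indicator (isOpen_ellipse a).measurableSet, ← integral_comp_ellPolar ha,
    ← hset, ← Measure.restrict_restrict hm, ← integral_indicator hm]
  refine setIntegral_congr_fun (measurableSet_Ioi.prod measurableSet_Ioo) fun q hq => ?_
  have h0 : (0 : ℝ) < q.1 := hq.1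
  by_cases h : q.1 < 1
  · simp [indicator, (ellPolar_mem_ellipse ha h0.le).2 h, h]
  · simp [indicator, mt (ellPolar_mem_ellipse ha h0.le).1 h, h]

lemma rectangle_ae_eq :
    (Ioo (0 : ℝ) 1 ×ˢ Ioo (-Real.pi) Real.pi : Set (ℝ × ℝ))
      =ᵐ[volume] Icc (0 : ℝ) 1 ×ˢ Icc (-Real.pi) Real.pi :=
  Measure.set_prod_ae_eq Ioo_ae_eq_Icc Ioo_ae_eq_Icc

lemma integrableOn_comp_ellPolar (ha : 0 < a) {f : ℝ × ℝ → ℝ}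
    (hf : ContinuousOn f (closedEllipse a)) :
    IntegrableOn (fun q : ℝ × ℝ => q.1 * f (ellPolar a q))
      (Icc (0 : ℝ) 1 ×ˢ Icc (-Real.pi) Real.pi) := by
  refine ContinuousOn.integrableOn_compact (isCompact_Icc.prod isCompact_Icc) ?_
  refine continuous_fst.continuousOn.mul (hf.comp (continuous_ellPolar a).continuousOn ?_)
  exact fun q hq => ellPolar_mem_closedEllipse ha hq.1.1 hq.1.2

lemma hasFDerivAt_ellPolar (a : ℝ) (q : ℝ × ℝ) :
    HasFDerivAt (ellPolar a) ((ellScale a).comp (fderivPolarCoordSymm q)) q := by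
  have h := (ellScale a).hasFDerivAt.comp q (hasFDerivAt_polarCoord_symm q)
  refine h.congr_of_eventuallyEq (Filter.Eventually.of_forall fun p => ?_)
  simp [ellPolar, ellScale_apply, polarCoord_symm_apply]

lemma fderivPolarCoordSymm_apply (q v : ℝ × ℝ) :
    fderivPolarCoordSymm q v
      = (Real.cos q.2 * v.1 - q.1 * Real.sin q.2 * v.2,
        Real.sin q.2 * v.1 + q.1 * Real.cos q.2 * v.2) := by
  simp [fderivPolarCoordSymm, Matrix.toLin_finTwoProd_apply, sub_eq_add_neg]

lemma linearMap_apply_pair (L : ℝ × ℝ →L[ℝ] ℝ) (x y : ℝ) :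
    L (x, y) = x * L (1, 0) + y * L (0, 1) := by
  have : ((x, y) : ℝ × ℝ) = x • (1, 0) + y • (0, 1) := by simp
  rw [this, map_add, map_smul, map_smul, smul_eq_mul, smul_eq_mul]

/-- The divergence theorem on the ellipse, for a vector field continuous up to the boundary and
differentiable inside, with divergence extending continuously to the boundary. -/
lemma divergence_theorem_ellipse (ha : 0 < a) {F₁ F₂ d : ℝ × ℝ → ℝ}
    {F₁' F₂' : ℝ × ℝ → ℝ × ℝ →L[ℝ] ℝ}
    (hF₁ : ContinuousOn F₁ (closedEllipse a)) (hF₂ : ContinuousOn F₂ (closedEllipse a))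
    (hd : ContinuousOn d (closedEllipse a))
    (hF₁' : ∀ p ∈ ellipse a, HasFDerivAt F₁ (F₁' p) p)
    (hF₂' : ∀ p ∈ ellipse a, HasFDerivAt F₂ (F₂' p) p)
    (hdiv : ∀ p ∈ ellipse a, F₁' p (1, 0) + F₂' p (0, 1) = d p) :
    ∫ p in ellipse a, d p = ∫ ψ in (0 : ℝ)..(2 * Real.pi),
      (F₁ (bdry a ψ) * (Real.cos ψ / a) + F₂ (bdry a ψ) * (a * Real.sin ψ)) := by
  have hpi : -Real.pi ≤ Real.pi := by linarith [Real.pi_pos]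
  have ha' : a ≠ 0 := ha.ne'
  -- The Piola transform of $(F_1,F_2)$: the field is multiplied by the cofactors of the Jacobian
  -- matrix of `ellPolar`, so that its divergence in $(r,\psi)$ is $r$ times the original
  -- divergence.
  set Gr : ℝ × ℝ → ℝ := fun q => q.1 *
    (F₁ (ellPolar a q) * (Real.cos q.2 / a) + F₂ (ellPolar a q) * (a * Real.sin q.2)) with hGr
  set Gψ : ℝ × ℝ → ℝ := fun q =>
    F₂ (ellPolar a q) * (a * Real.cos q.2) - F₁ (ellPolar a q) * (Real.sin q.2 / a) with hGψ
  have hmaps : MapsTo (ellPolar a) (Icc (0 : ℝ) 1 ×ˢ Icc (-Real.pi) Real.pi) (closedEllipse a) :=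
    fun q hq => ellPolar_mem_closedEllipse ha hq.1.1 hq.1.2
  have c1 := hF₁.comp (continuous_ellPolar a).continuousOn hmaps
  have c2 := hF₂.comp (continuous_ellPolar a).continuousOn hmaps
  have hGrc : ContinuousOn Gr (Icc (0 : ℝ) 1 ×ˢ Icc (-Real.pi) Real.pi) := by
    have e1 : Continuous fun q : ℝ × ℝ => Real.cos q.2 / a := by fun_prop
    have e2 : Continuous fun q : ℝ × ℝ => a * Real.sin q.2 := by fun_prop
    exact continuous_fst.continuousOn.mul
      ((c1.mul e1.continuousOn).add (c2.mul e2.continuousOn))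
  have hGψc : ContinuousOn Gψ (Icc (0 : ℝ) 1 ×ˢ Icc (-Real.pi) Real.pi) := by
    have e1 : Continuous fun q : ℝ × ℝ => Real.sin q.2 / a := by fun_prop
    have e2 : Continuous fun q : ℝ × ℝ => a * Real.cos q.2 := by fun_prop
    exact (c2.mul e2.continuousOn).sub (c1.mul e1.continuousOn)
  have hdiffr : ∀ q ∈ Ioo (0 : ℝ) 1 ×ˢ Ioo (-Real.pi) Real.pi, DifferentiableAt ℝ Gr q := by
    intro q hq
    have hm := (ellPolar_mem_ellipse ha hq.1.1.le).2 hq.1.2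
    have h1 : DifferentiableAt ℝ (fun q => F₁ (ellPolar a q)) q :=
      ((hF₁' _ hm).comp q (hasFDerivAt_ellPolar a q)).differentiableAt
    have h2 : DifferentiableAt ℝ (fun q => F₂ (ellPolar a q)) q :=
      ((hF₂' _ hm).comp q (hasFDerivAt_ellPolar a q)).differentiableAt
    exact differentiableAt_fst.mul ((h1.mul (by fun_prop)).add (h2.mul (by fun_prop)))
  have hdiffψ : ∀ q ∈ Ioo (0 : ℝ) 1 ×ˢ Ioo (-Real.pi) Real.pi, DifferentiableAt ℝ Gψ q := by
    intro q hq
    have hm := (ellPolar_mem_ellipse ha hq.1.1.le).2 hq.1.2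
    have h1 : DifferentiableAt ℝ (fun q => F₁ (ellPolar a q)) q :=
      ((hF₁' _ hm).comp q (hasFDerivAt_ellPolar a q)).differentiableAt
    have h2 : DifferentiableAt ℝ (fun q => F₂ (ellPolar a q)) q :=
      ((hF₂' _ hm).comp q (hasFDerivAt_ellPolar a q)).differentiableAt
    exact (h2.mul (by fun_prop)).sub (h1.mul (by fun_prop))
  have hpiola : ∀ q ∈ Ioo (0 : ℝ) 1 ×ˢ Ioo (-Real.pi) Real.pi,
      fderiv ℝ Gr q (1, 0) + fderiv ℝ Gψ q (0, 1) = q.1 * d (ellPolar a q) := by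
    intro q hq
    have hm := (ellPolar_mem_ellipse ha hq.1.1.le).2 hq.1.2
    have h1 := (hF₁' _ hm).comp q (hasFDerivAt_ellPolar a q)
    have h2 := (hF₂' _ hm).comp q (hasFDerivAt_ellPolar a q)
    have hs : HasFDerivAt (fun q : ℝ × ℝ => Real.sin q.2)
        (Real.cos q.2 • ContinuousLinearMap.snd ℝ ℝ ℝ) q :=
      (Real.hasDerivAt_sin q.2).comp_hasFDerivAt q hasFDerivAt_snd
    have hc : HasFDerivAt (fun q : ℝ × ℝ => Real.cos q.2)
        (-Real.sin q.2 • ContinuousLinearMap.snd ℝ ℝ ℝ) q :=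
      (Real.hasDerivAt_cos q.2).comp_hasFDerivAt q hasFDerivAt_snd
    have dr := (hasFDerivAt_fst (𝕜 := ℝ) (p := q)).mul
      ((h1.mul (hc.mul_const (1 / a))).add (h2.mul (hs.const_mul a)))
    have dψ := (h2.mul (hc.const_mul a)).sub (h1.mul (hs.mul_const (1 / a)))
    have er : Gr = Prod.fst * (((F₁ ∘ ellPolar a) * fun q => Real.cos q.2 * (1 / a)) +
        (F₂ ∘ ellPolar a) * fun q => a * Real.sin q.2) := by
      ext x; simp [hGr, div_eq_mul_inv]
    have eψ : Gψ = ((F₂ ∘ ellPolar a) * fun q => a * Real.cos q.2) -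
        (F₁ ∘ ellPolar a) * fun q => Real.sin q.2 * (1 / a) := by
      ext x; simp [hGψ, div_eq_mul_inv]
    rw [er, eψ, dr.fderiv, dψ.fderiv, ← hdiv _ hm]
    have hsc := Real.sin_sq_add_cos_sq q.2
    simp only [add_apply, sub_apply,
      smul_apply, ContinuousLinearMap.comp_apply, fderivPolarCoordSymm_apply,
      ellScale_apply, smul_eq_mul, ContinuousLinearMap.coe_fst', ContinuousLinearMap.coe_snd',
      Function.comp_apply, Pi.add_apply, Pi.mul_apply, mul_one, mul_zero, add_zero, sub_zero,
      zero_add, zero_sub]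
    rw [linearMap_apply_pair (F₁' _) (a * _), linearMap_apply_pair (F₁' _) (a * _),
      linearMap_apply_pair (F₂' _) (a * _), linearMap_apply_pair (F₂' _) (a * _)]
    have hs2 : Real.sin q.2 ^ 2 = 1 - Real.cos q.2 ^ 2 := by linarith
    field_simp
    ring_nf
    simp only [hs2]
    ring
  -- The divergence formula is known only on the open rectangle, since nothing is assumed about
  -- derivatives on $\partial\Omega$; the edges have measure zero.
  have hII : IntegrableOn (fun q => fderiv ℝ Gr q (1, 0) + fderiv ℝ Gψ q (0, 1))
      (Icc (0 : ℝ) 1 ×ˢ Icc (-Real.pi) Real.pi) := by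
    refine IntegrableOn.congr_set_ae ?_ rectangle_ae_eq.symm
    refine IntegrableOn.congr_fun ?_ (fun q hq => (hpiola q hq).symm)
      (measurableSet_Ioo.prod measurableSet_Ioo)
    exact (integrableOn_comp_ellPolar ha hd).congr_set_ae rectangle_ae_eq
  have key := integral2_divergence_prod_of_hasFDerivAt_off_countable Gr Gψ
    (fderiv ℝ Gr) (fderiv ℝ Gψ) 0 (-Real.pi) 1 Real.pi ∅ countable_empty
    (by rwa [uIcc_of_le zero_le_one, uIcc_of_le hpi])
    (by rwa [uIcc_of_le zero_le_one, uIcc_of_le hpi])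
    (by
      rw [min_eq_left zero_le_one, max_eq_right zero_le_one, min_eq_left hpi, max_eq_right hpi]
      exact fun q hq => (hdiffr q hq.1).hasFDerivAt)
    (by
      rw [min_eq_left zero_le_one, max_eq_right zero_le_one, min_eq_left hpi, max_eq_right hpi]
      exact fun q hq => (hdiffψ q hq.1).hasFDerivAt)
    (by rwa [uIcc_of_le zero_le_one, uIcc_of_le hpi])
  have hleft : ∫ p in ellipse a, d p = ∫ r in (0 : ℝ)..1, ∫ ψ in (-Real.pi)..Real.pi,
      fderiv ℝ Gr (r, ψ) (1, 0) + fderiv ℝ Gψ (r, ψ) (0, 1) := by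
    rw [setIntegral_ellipse ha,
      setIntegral_congr_fun (measurableSet_Ioo.prod measurableSet_Ioo)
        (fun q hq => (hpiola q hq).symm),
      setIntegral_congr_set rectangle_ae_eq, Measure.volume_eq_prod,
      setIntegral_prod _ hII, integral_Icc_eq_integral_Ioc,
      intervalIntegral.integral_of_le zero_le_one]
    simp only [integral_Icc_eq_integral_Ioc, intervalIntegral.integral_of_le hpi]
  -- Only the edge $r=1$ contributes: the factor $r$ kills the flux at $r=0$, and the edges
  -- $\psi=\pm\pi$ cancel. Periodicity moves the remaining integral to $[0,2\pi]$.
  have hper : Function.Periodic (fun ψ => F₁ (bdry a ψ) * (Real.cos ψ / a)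
      + F₂ (bdry a ψ) * (a * Real.sin ψ)) (2 * Real.pi) := by
    intro ψ
    simp [bdry]
  have hends : ∀ r : ℝ, Gψ (r, Real.pi) = Gψ (r, -Real.pi) := by
    intro r
    simp [hGψ, ellPolar]
  rw [hleft, key]
  have h0 : ∀ ψ : ℝ, Gr (0, ψ) = 0 := fun ψ => by simp [hGr]
  have h1 : ∀ ψ : ℝ, Gr (1, ψ) = F₁ (bdry a ψ) * (Real.cos ψ / a)
      + F₂ (bdry a ψ) * (a * Real.sin ψ) := fun ψ => by simp [hGr, ellPolar_one]
  simp only [hends, h0, h1, sub_self, intervalIntegral.integral_zero, sub_zero, zero_add]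
  have h := hper.intervalIntegral_add_eq (-Real.pi) 0
  rw [zero_add, show -Real.pi + 2 * Real.pi = Real.pi by ring] at h
  exact h

/-! ### Green's identity and the energy identity -/

lemma IsC2C1.hasFDerivAt {u : ℝ × ℝ → ℝ} {g : ℝ × ℝ → ℝ × ℝ} (hu : IsC2C1 a u g) {p : ℝ × ℝ}
    (hp : p ∈ ellipse a) : HasFDerivAt u (fderiv ℝ u p) p :=
  ((hu.contDiffOn.contDiffAt ((isOpen_ellipse a).mem_nhds hp)).differentiableAt
    (by norm_num)).hasFDerivAt

lemma IsC2C1.differentiableAt_fderiv {u : ℝ × ℝ → ℝ} {g : ℝ × ℝ → ℝ × ℝ} (hu : IsC2C1 a u g)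
    {p : ℝ × ℝ} (hp : p ∈ ellipse a) (v : ℝ × ℝ) :
    DifferentiableAt ℝ (fun x => fderiv ℝ u x v) p := by
  have h : ContDiffAt ℝ 1 (fderiv ℝ u) p :=
    (hu.contDiffOn.contDiffAt ((isOpen_ellipse a).mem_nhds hp)).fderiv_right (by norm_num)
  exact (h.differentiableAt (by norm_num)).clm_apply (differentiableAt_const v)

lemma speed_pos (ha : 0 < a) (ψ : ℝ) : 0 < speed a ψ := by
  unfold speed
  refine Real.sqrt_pos.2 ?_
  have h := Real.sin_sq_add_cos_sq ψ
  rcases eq_or_ne (Real.sin ψ) 0 with h0 | h0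
  · have : 0 < Real.cos ψ ^ 2 := by rw [h0] at h; nlinarith
    positivity
  · positivity

lemma continuous_speed (a : ℝ) : Continuous (speed a) := by
  unfold speed
  fun_prop

/-- The vector element $n\,ds=(\cos\psi/a,\,a\sin\psi)\,d\psi$ contains no square root; this matches
the flux in `divergence_theorem_ellipse`. -/
lemma normalComp_mul_speed (ha : 0 < a) (g : ℝ × ℝ → ℝ × ℝ) (ψ : ℝ) :
    normalComp a g ψ * speed a ψ
      = (g (bdry a ψ)).1 * (Real.cos ψ / a) + (g (bdry a ψ)).2 * (a * Real.sin ψ) := by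
  have h := (speed_pos ha ψ).ne'
  unfold normalComp normal
  field_simp

/-- Divergence theorem for $w\nabla u$. Because $\Delta u=-1$, its divergence $\nabla w\cdot\nabla
u-w$ extends continuously to the boundary although second derivatives of $u$ need not. -/
lemma green_identity (ha : 0 < a) {u w : ℝ × ℝ → ℝ} {g h : ℝ × ℝ → ℝ × ℝ}
    (hu : IsC2C1 a u g) (hw : IsC2C1 a w h) (hlap : ∀ p ∈ ellipse a, -laplacian u p = 1) :
    ∫ p in ellipse a, ((h p).1 * (g p).1 + (h p).2 * (g p).2 - w p)
      = ∫ ψ in (0 : ℝ)..(2 * Real.pi), w (bdry a ψ) * normalComp a g ψ * speed a ψ := by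
  have c1 := hu.grad_continuousOn.fst
  have c2 := hu.grad_continuousOn.snd
  have cw := hw.continuousOn
  have main := divergence_theorem_ellipse ha (F₁ := fun p => w p * (g p).1)
    (F₂ := fun p => w p * (g p).2)
    (d := fun p => (h p).1 * (g p).1 + (h p).2 * (g p).2 - w p)
    (F₁' := fun p => w p • fderiv ℝ (dx u) p + dx u p • fderiv ℝ w p)
    (F₂' := fun p => w p • fderiv ℝ (dy u) p + dy u p • fderiv ℝ w p)
    (cw.mul c1) (cw.mul c2)
    (((hw.grad_continuousOn.fst.mul c1).add (hw.grad_continuousOn.snd.mul c2)).sub cw)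
    ?_ ?_ ?_
  · rw [main]
    refine intervalIntegral.integral_congr fun ψ _ => ?_
    simp only [mul_assoc, normalComp_mul_speed ha]
    ring
  · intro p hp
    refine ((hw.hasFDerivAt hp).mul
      (hu.differentiableAt_fderiv hp (1, 0)).hasFDerivAt).congr_of_eventuallyEq ?_
    filter_upwards [(isOpen_ellipse a).mem_nhds hp] with x hx
    simp [hu.grad_eq x hx, dx]
  · intro p hp
    refine ((hw.hasFDerivAt hp).mul
      (hu.differentiableAt_fderiv hp (0, 1)).hasFDerivAt).congr_of_eventuallyEq ?_
    filter_upwards [(isOpen_ellipse a).mem_nhds hp] with x hx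
    simp [hu.grad_eq x hx, dy]
  · intro p hp
    have hl := hlap p hp
    rw [hu.grad_eq p hp, hw.grad_eq p hp]
    simp only [add_apply, smul_apply, smul_eq_mul]
    have e1 : fderiv ℝ (dx u) p (1, 0) + fderiv ℝ (dy u) p (0, 1) = -1 := by
      have : laplacian u p = fderiv ℝ (dx u) p (1, 0) + fderiv ℝ (dy u) p (0, 1) := rfl
      linarith
    have e2 : fderiv ℝ w p (1, 0) = dx w p := rfl
    have e3 : fderiv ℝ w p (0, 1) = dy w p := rfl
    rw [e2, e3]
    linear_combination w p * e1

/-- Pointwise, $2v-|h|^2+|h-g|^2=u+(|g|^2-u)-2(h\cdot g-v)$; Green's identity with $w=u$ and $w=v$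
turns the brackets into boundary terms. -/
lemma energy_identity (ha : 0 < a) {u v : ℝ × ℝ → ℝ} {g h : ℝ × ℝ → ℝ × ℝ}
    (hu : IsC2C1 a u g) (hv : IsC2C1 a v h) (hlap : ∀ p ∈ ellipse a, -laplacian u p = 1) :
    functionalA a v + ∫ p in ellipse a, (((h p).1 - (g p).1) ^ 2 + ((h p).2 - (g p).2) ^ 2)
      = (∫ p in ellipse a, u p)
        + (∫ ψ in (0 : ℝ)..(2 * Real.pi), u (bdry a ψ) * normalComp a g ψ * speed a ψ)
        - 2 * ∫ ψ in (0 : ℝ)..(2 * Real.pi), v (bdry a ψ) * normalComp a g ψ * speed a ψ := by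
  have g1 := hu.grad_continuousOn.fst
  have g2 := hu.grad_continuousOn.snd
  have h1 := hv.grad_continuousOn.fst
  have h2 := hv.grad_continuousOn.snd
  have cu := hu.continuousOn
  have cv := hv.continuousOn
  have hA : functionalA a v
      = ∫ p in ellipse a, (2 * v p - ((h p).1 ^ 2 + (h p).2 ^ 2)) := by
    refine setIntegral_congr_fun (isOpen_ellipse a).measurableSet fun p hp => ?_
    simp only [hv.grad_eq p hp, gradSq]
  rw [hA, ← green_identity ha hu hu hlap, ← green_identity ha hu hv hlap, ← integral_const_mul,
    ← integral_add, ← integral_add, ← integral_sub]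
  · congr 1
    ext p
    ring
  all_goals refine integrableOn_ellipse ha ?_; fun_prop

lemma normalComp_congr {g g' : ℝ × ℝ → ℝ × ℝ} {ψ : ℝ} (h : g (bdry a ψ) = g' (bdry a ψ)) :
    normalComp a g ψ = normalComp a g' ψ := by
  unfold normalComp
  rw [h]

lemma continuous_comp_bdry (ha : 0 < a) {f : ℝ × ℝ → ℝ} (hf : ContinuousOn f (closedEllipse a)) :
    Continuous fun ψ => f (bdry a ψ) :=
  hf.comp_continuous (continuous_bdry a) (bdry_mem_closedEllipse ha)

lemma functionalJ_le_of_solvesSlip (ha : 0 < a) {β : ℝ} (hβ : 0 < β) {u v : ℝ × ℝ → ℝ}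
    {h : ℝ × ℝ → ℝ × ℝ} (hu : SolvesSlip a β u) (hv : IsC2C1 a v h) :
    functionalJ a β v ≤ ∫ p in ellipse a, u p := by
  obtain ⟨g, hg, hlap, hbc⟩ := hu
  have hn : ∀ ψ, normalComp a g ψ = -(1 / β) * u (bdry a ψ) := by
    intro ψ
    have := hbc ψ
    field_simp
    linarith
  have key := energy_identity ha hg hv hlap
  have h0 : 0 ≤ ∫ p in ellipse a, (((h p).1 - (g p).1) ^ 2 + ((h p).2 - (g p).2) ^ 2) :=
    integral_nonneg fun p => by positivity
  have cu := continuous_comp_bdry ha hg.continuousOn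
  have cv := continuous_comp_bdry ha hv.continuousOn
  have cs := continuous_speed a
  have hB : (∫ ψ in (0 : ℝ)..(2 * Real.pi), u (bdry a ψ) * normalComp a g ψ * speed a ψ)
        - 2 * (∫ ψ in (0 : ℝ)..(2 * Real.pi), v (bdry a ψ) * normalComp a g ψ * speed a ψ)
        - 1 / β * functionalB a v
      = -(1 / β * ∫ ψ in (0 : ℝ)..(2 * Real.pi),
          (u (bdry a ψ) - v (bdry a ψ)) ^ 2 * speed a ψ) := by
    simp only [functionalB, bdryIntegral, hn]
    -- Only the boundary traces are known to be continuous on their whole domain, so they replace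
    -- $u$ and $v$ in the integrability goals.
    generalize hU : (fun ψ => u (bdry a ψ)) = U at cu
    generalize hV : (fun ψ => v (bdry a ψ)) = V at cv
    have eU : ∀ ψ, u (bdry a ψ) = U ψ := congrFun hU
    have eV : ∀ ψ, v (bdry a ψ) = V ψ := congrFun hV
    simp only [eU, eV]
    rw [← intervalIntegral.integral_const_mul, ← intervalIntegral.integral_const_mul,
      ← intervalIntegral.integral_const_mul, ← intervalIntegral.integral_sub,
      ← intervalIntegral.integral_sub, ← intervalIntegral.integral_neg]
    · congr 1
      ext ψ
      ring
    all_goals refine Continuous.intervalIntegrable ?_ _ _; fun_prop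
  have hI : 0 ≤ ∫ ψ in (0 : ℝ)..(2 * Real.pi),
      (u (bdry a ψ) - v (bdry a ψ)) ^ 2 * speed a ψ :=
    intervalIntegral.integral_nonneg (by positivity)
      fun ψ _ => mul_nonneg (sq_nonneg _) (speed_pos ha ψ).le
  have hI' : 0 ≤ 1 / β * ∫ ψ in (0 : ℝ)..(2 * Real.pi),
      (u (bdry a ψ) - v (bdry a ψ)) ^ 2 * speed a ψ := mul_nonneg (by positivity) hI
  unfold functionalJ
  linarith

/-! ### Comparison with the limiting Neumann problem -/

lemma closedEllipse_subset_closure (a : ℝ) : closedEllipse a ⊆ closure (ellipse a) := by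
  intro p hp
  have hp : p.1 ^ 2 / a ^ 2 + a ^ 2 * p.2 ^ 2 ≤ 1 := hp
  have h0 : 0 ≤ p.1 ^ 2 / a ^ 2 + a ^ 2 * p.2 ^ 2 := by positivity
  have ht : Filter.Tendsto (fun r : ℝ => r • p) (nhdsWithin 1 (Ioo 0 1)) (nhds p) := by
    have : Continuous fun r : ℝ => r • p := by fun_prop
    simpa using (this.tendsto 1).mono_left nhdsWithin_le_nhds
  have : (nhdsWithin (1 : ℝ) (Ioo 0 1)).NeBot := by
    rw [← mem_closure_iff_nhdsWithin_neBot, closure_Ioo zero_ne_one]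
    exact right_mem_Icc.2 zero_le_one
  refine mem_closure_of_tendsto ht ?_
  filter_upwards [self_mem_nhdsWithin] with r hr
  have hr2 : r ^ 2 < 1 := (sq_lt_one_iff₀ hr.1.le).2 hr.2
  change (r * p.1) ^ 2 / a ^ 2 + a ^ 2 * (r * p.2) ^ 2 < 1
  have : (r * p.1) ^ 2 / a ^ 2 + a ^ 2 * (r * p.2) ^ 2
      = r ^ 2 * (p.1 ^ 2 / a ^ 2 + a ^ 2 * p.2 ^ 2) := by ring
  rw [this]
  nlinarith [sq_nonneg r]

/-- A continuous nonnegative integrand with zero integral vanishes on the open ellipse, and by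
density on the boundary, where normal derivatives are read off. -/
lemma grad_eq_of_integral_sq_eq_zero (ha : 0 < a) {g h : ℝ × ℝ → ℝ × ℝ}
    (hg : ContinuousOn g (closedEllipse a)) (hh : ContinuousOn h (closedEllipse a))
    (h0 : ∫ p in ellipse a, (((h p).1 - (g p).1) ^ 2 + ((h p).2 - (g p).2) ^ 2) = 0)
    {p : ℝ × ℝ} (hp : p ∈ closedEllipse a) : h p = g p := by
  have g1 := hg.fst
  have g2 := hg.snd
  have h1 := hh.fst
  have h2 := hh.snd
  have hc : ContinuousOn (fun p => ((h p).1 - (g p).1) ^ 2 + ((h p).2 - (g p).2) ^ 2)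
      (closedEllipse a) := by fun_prop
  rw [setIntegral_eq_zero_iff_of_nonneg_ae
    (Filter.Eventually.of_forall fun p => by dsimp; positivity) (integrableOn_ellipse ha hc)] at h0
  have e1 := Measure.eqOn_open_of_ae_eq h0 (isOpen_ellipse a)
    (hc.mono (ellipse_subset_closedEllipse a)) continuousOn_const
  have e2 := e1.of_subset_closure hc continuousOn_const (ellipse_subset_closedEllipse a)
    (closedEllipse_subset_closure a) hp
  simp only [Pi.zero_apply] at e2
  refine Prod.ext ?_ ?_
  · nlinarith [sq_nonneg ((h p).1 - (g p).1), sq_nonneg ((h p).2 - (g p).2)]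
  · nlinarith [sq_nonneg ((h p).1 - (g p).1), sq_nonneg ((h p).2 - (g p).2)]

lemma functionalA_of_solvesInfinity (ha : 0 < a) {u v : ℝ × ℝ → ℝ}
    {h : ℝ × ℝ → ℝ × ℝ} (hu : SolvesInfinity a u) (hv : IsC2C1 a v h)
    (hv0 : bdryIntegral a v = 0) :
    functionalA a v ≤ ∫ p in ellipse a, u p ∧
      (functionalA a v = ∫ p in ellipse a, u p →
        ∀ ψ, normalComp a h ψ = -(area a / perimeter a)) := by
  obtain ⟨g, hg, hlap, hbc, hu0⟩ := hu
  have key := energy_identity ha hg hv hlap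
  have hb : ∀ f : ℝ × ℝ → ℝ, bdryIntegral a f = 0 →
      ∫ ψ in (0 : ℝ)..(2 * Real.pi), f (bdry a ψ) * normalComp a g ψ * speed a ψ = 0 := by
    intro f hf
    have : ∀ ψ, f (bdry a ψ) * normalComp a g ψ * speed a ψ
        = -(area a / perimeter a) * (f (bdry a ψ) * speed a ψ) := by
      intro ψ
      rw [hbc]
      ring
    simp only [this, intervalIntegral.integral_const_mul]
    change _ * bdryIntegral a f = 0
    rw [hf, mul_zero]
  rw [hb u hu0, hb v hv0] at key
  have h0 : 0 ≤ ∫ p in ellipse a, (((h p).1 - (g p).1) ^ 2 + ((h p).2 - (g p).2) ^ 2) :=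
    integral_nonneg fun p => by positivity
  refine ⟨by linarith, fun he ψ => ?_⟩
  rw [← hbc ψ]
  exact normalComp_congr (grad_eq_of_integral_sq_eq_zero ha hg.grad_continuousOn
    hv.grad_continuousOn (by linarith) (bdry_mem_closedEllipse ha ψ))

/-! ### Boundary moments and elliptic integrals -/

attribute [fun_prop] continuous_speed continuous_bdry

lemma speed_sq (a ψ : ℝ) :
    speed a ψ ^ 2 = a ^ 2 * Real.sin ψ ^ 2 + Real.cos ψ ^ 2 / a ^ 2 :=
  Real.sq_sqrt (by positivity)

lemma hasDerivAt_speed (ha : 0 < a) (ψ : ℝ) :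
    HasDerivAt (speed a) (Real.sin ψ * Real.cos ψ * (a ^ 2 - 1 / a ^ 2) / speed a ψ) ψ := by
  have hpos := speed_pos ha ψ
  have hne : a ^ 2 * Real.sin ψ ^ 2 + Real.cos ψ ^ 2 / a ^ 2 ≠ 0 := by
    rw [← speed_sq]
    positivity
  have h := (((((Real.hasDerivAt_sin ψ).pow 2).const_mul (a ^ 2)).add
    (((Real.hasDerivAt_cos ψ).pow 2).div_const (a ^ 2)))).sqrt hne
  refine h.congr_deriv ?_
  have e : √(a ^ 2 * Real.sin ψ ^ 2 + Real.cos ψ ^ 2 / a ^ 2) = speed a ψ := rfl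
  simp only [Pi.add_apply, Pi.pow_apply, e]
  field_simp
  ring

lemma sin_mul_cos_sq_speed (ha : 0 < a) (ψ : ℝ) :
    (a ^ 2 - 1 / a ^ 2) ^ 2 * (Real.sin ψ * Real.cos ψ) ^ 2
      = (speed a ψ ^ 2 - 1 / a ^ 2) * (a ^ 2 - speed a ψ ^ 2) := by
  rw [speed_sq, mul_pow, Real.cos_sq']
  field_simp
  ring

lemma cos_sq_sub_sin_sq_speed (ha : 0 < a) (ψ : ℝ) :
    (a ^ 2 - 1 / a ^ 2) * (Real.cos ψ ^ 2 - Real.sin ψ ^ 2)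
      = a ^ 2 + 1 / a ^ 2 - 2 * speed a ψ ^ 2 := by
  rw [speed_sq, Real.cos_sq']
  field_simp
  ring

/-- The integrand is the derivative of $(a^2-a^{-2})\sin\psi\cos\psi\,s^{n+1}$, which vanishes at
both endpoints. It involves only powers of $s$, as $(\sin\psi\cos\psi)^2$ and
$\cos^2\psi-\sin^2\psi$ are polynomials in $s^2$. The quotient $s^n/s$ gives $1/s$ at $n=0$. -/
lemma integral_speed_recurrence (ha : 0 < a) (n : ℕ) :
    ∫ ψ in (0 : ℝ)..(2 * Real.pi),
      ((n + 2) * (a ^ 2 + 1 / a ^ 2) * speed a ψ ^ (n + 1) - (n + 3) * speed a ψ ^ (n + 3)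
        - (n + 1) * (speed a ψ ^ n / speed a ψ)) = 0 := by
  have hd : ∀ ψ : ℝ, HasDerivAt
      (fun ψ => (a ^ 2 - 1 / a ^ 2) * (Real.sin ψ * Real.cos ψ * speed a ψ ^ (n + 1)))
      ((n + 2) * (a ^ 2 + 1 / a ^ 2) * speed a ψ ^ (n + 1) - (n + 3) * speed a ψ ^ (n + 3)
        - (n + 1) * (speed a ψ ^ n / speed a ψ)) ψ := by
    intro ψ
    have hne := (speed_pos ha ψ).ne'
    have h := (((Real.hasDerivAt_sin ψ).mul (Real.hasDerivAt_cos ψ)).mul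
      ((hasDerivAt_speed ha ψ).pow (n + 1))).const_mul (a ^ 2 - 1 / a ^ 2)
    refine h.congr_deriv ?_
    have e1 := sin_mul_cos_sq_speed ha ψ
    have e2 := cos_sq_sub_sin_sq_speed ha ψ
    have e3 : a ^ 2 * (1 / a ^ 2) = 1 := by field_simp
    have e4 : speed a ψ * (speed a ψ)⁻¹ = 1 := mul_inv_cancel₀ hne
    simp only [Pi.mul_apply, Pi.pow_apply, Nat.add_sub_cancel, div_eq_mul_inv _ (speed a ψ)]
    push_cast
    -- The reciprocals become independent letters tied only by `e3` and `e4`, leaving a polynomial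
    -- identity.
    generalize (speed a ψ)⁻¹ = i at *
    generalize speed a ψ = s at *
    generalize 1 / a ^ 2 = q at *
    generalize a ^ 2 = p at *
    linear_combination s ^ (n + 1) * e2 + (n + 1) * s ^ n * i * e1
      - (n + 1) * s ^ n * i * e3 + (n + 1) * s ^ n * s * ((p + q) - s ^ 2) * e4
  rw [intervalIntegral.integral_eq_sub_of_hasDerivAt (fun ψ _ => hd ψ)]
  · simp
  · refine Continuous.intervalIntegrable ?_ _ _
    have : Continuous fun ψ => speed a ψ ^ n / speed a ψ :=
      ((continuous_speed a).pow n).div (continuous_speed a) fun ψ => (speed_pos ha ψ).ne'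
    fun_prop

lemma integral_speed_pow_succ (ha : 0 < a) (n : ℕ) :
    (n + 3) * ∫ ψ in (0 : ℝ)..(2 * Real.pi), speed a ψ ^ (n + 3)
      = (n + 2) * (a ^ 2 + 1 / a ^ 2) * (∫ ψ in (0 : ℝ)..(2 * Real.pi), speed a ψ ^ (n + 1))
        - (n + 1) * ∫ ψ in (0 : ℝ)..(2 * Real.pi), speed a ψ ^ n / speed a ψ := by
  have h := integral_speed_recurrence ha n
  have hc : Continuous fun ψ => speed a ψ ^ n / speed a ψ :=
      ((continuous_speed a).pow n).div (continuous_speed a) fun ψ => (speed_pos ha ψ).ne'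
  rw [intervalIntegral.integral_sub, intervalIntegral.integral_sub,
    intervalIntegral.integral_const_mul, intervalIntegral.integral_const_mul,
    intervalIntegral.integral_const_mul] at h
  · linarith
  all_goals exact Continuous.intervalIntegrable (by fun_prop) _ _

lemma perimeter_eq (a : ℝ) : perimeter a = ∫ ψ in (0 : ℝ)..(2 * Real.pi), speed a ψ := by
  simp [perimeter, bdryIntegral]

lemma perimeter_pos (ha : 0 < a) : 0 < perimeter a := by
  rw [perimeter_eq]
  exact intervalIntegral.intervalIntegral_pos_of_pos
    ((continuous_speed a).intervalIntegrable _ _) (speed_pos ha) (by positivity)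

lemma bdryIntegral_add {f g : ℝ × ℝ → ℝ} (hf : Continuous f) (hg : Continuous g) :
    bdryIntegral a (fun p => f p + g p) = bdryIntegral a f + bdryIntegral a g := by
  unfold bdryIntegral
  rw [← intervalIntegral.integral_add]
  · simp only [add_mul]
  all_goals exact Continuous.intervalIntegrable (by fun_prop) _ _

lemma bdryIntegral_const_mul (c : ℝ) (f : ℝ × ℝ → ℝ) :
    bdryIntegral a (fun p => c * f p) = c * bdryIntegral a f := by
  unfold bdryIntegral
  rw [← intervalIntegral.integral_const_mul]
  simp only [mul_assoc]

lemma bdryIntegral_congr {f g : ℝ × ℝ → ℝ} (h : ∀ ψ, f (bdry a ψ) = g (bdry a ψ)) :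
    bdryIntegral a f = bdryIntegral a g := by
  unfold bdryIntegral
  simp only [h]

lemma bdry_sq_add_sq (ha : 0 < a) (ψ : ℝ) :
    (bdry a ψ).1 ^ 2 + (bdry a ψ).2 ^ 2 = a ^ 2 + 1 / a ^ 2 - speed a ψ ^ 2 := by
  rw [speed_sq]
  simp only [bdry, mul_pow, div_pow, Real.cos_sq']
  field_simp
  ring

lemma bdry_sq_sub_sq (ha : 0 < a) (ψ : ℝ) :
    (-1 + a ^ 4) * ((bdry a ψ).1 ^ 2 - (bdry a ψ).2 ^ 2)
      = -2 * a ^ 2 + (1 + a ^ 4) * ((bdry a ψ).1 ^ 2 + (bdry a ψ).2 ^ 2) := by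
  simp only [bdry, mul_pow, div_pow, Real.cos_sq']
  field_simp
  ring

lemma bdry_mem_boundary (ha : 0 < a) (ψ : ℝ) :
    (bdry a ψ).1 ^ 2 / a ^ 2 + a ^ 2 * (bdry a ψ).2 ^ 2 = 1 := by
  simp only [bdry, mul_pow, div_pow, Real.cos_sq']
  field_simp
  ring

/-- On the boundary $x^2+y^2=a^2+a^{-2}-s^2$, so the moment involves $\int s$ and $\int s^3$; the
recurrence at $n=0$ removes the cube. The next moment also uses $n=2$. -/
lemma bdryMoment_one_eq (ha : 0 < a) :
    bdryMoment 1 a = 1 / 3 * ((a ^ 2 + 1 / a ^ 2) * perimeter a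
      + ∫ ψ in (0 : ℝ)..(2 * Real.pi), 1 / speed a ψ) := by
  have h := integral_speed_pow_succ ha 0
  simp only [Nat.cast_zero, zero_add, pow_one, pow_zero, ← perimeter_eq] at h
  have : bdryMoment 1 a = (a ^ 2 + 1 / a ^ 2) * perimeter a
      - ∫ ψ in (0 : ℝ)..(2 * Real.pi), speed a ψ ^ 3 := by
    rw [perimeter_eq, ← intervalIntegral.integral_const_mul, ← intervalIntegral.integral_sub]
    · refine intervalIntegral.integral_congr fun ψ _ => ?_
      simp only [pow_one, bdry_sq_add_sq ha]
      ring
    all_goals exact Continuous.intervalIntegrable (by fun_prop) _ _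
  rw [this]
  linarith

lemma bdryMoment_two_eq (ha : 0 < a) :
    bdryMoment 2 a = 1 / 5 * (((a ^ 2 + 1 / a ^ 2) ^ 2 - 3) * perimeter a
      + 2 * (a ^ 2 + 1 / a ^ 2) * ∫ ψ in (0 : ℝ)..(2 * Real.pi), 1 / speed a ψ) := by
  have h := integral_speed_pow_succ ha 0
  have h2 := integral_speed_pow_succ ha 2
  have e : ∀ ψ, speed a ψ ^ 2 / speed a ψ = speed a ψ := fun ψ => by
    have := (speed_pos ha ψ).ne'
    field_simp
  simp only [Nat.cast_zero, zero_add, pow_one, pow_zero, ← perimeter_eq] at h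
  simp only [e, ← perimeter_eq, Nat.cast_ofNat] at h2
  norm_num at h2
  have : bdryMoment 2 a = (a ^ 2 + 1 / a ^ 2) ^ 2 * perimeter a
      - 2 * (a ^ 2 + 1 / a ^ 2) * (∫ ψ in (0 : ℝ)..(2 * Real.pi), speed a ψ ^ 3)
      + ∫ ψ in (0 : ℝ)..(2 * Real.pi), speed a ψ ^ 5 := by
    rw [perimeter_eq, ← intervalIntegral.integral_const_mul,
      ← intervalIntegral.integral_const_mul, ← intervalIntegral.integral_sub,
      ← intervalIntegral.integral_add]
    · refine intervalIntegral.integral_congr fun ψ _ => ?_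
      simp only [bdry_sq_add_sq ha]
      ring
    all_goals exact Continuous.intervalIntegrable (by fun_prop) _ _
  rw [this]
  simp only [one_div] at h ⊢
  linear_combination 1 / 5 * h2 + (4 / 15 - 2 / 3) * (a ^ 2 + (a ^ 2)⁻¹) * h

/-- The equation of the ellipse makes $x^2-y^2$ an affine function of $x^2+y^2$ on $\partial\Omega$
when $a\ne1$. -/
lemma momentC1_eq (ha : 0 < a) : (-1 + a ^ 4) * momentC1 a
    = -2 * a ^ 2 * perimeter a + (1 + a ^ 4) * bdryMoment 1 a := by
  unfold momentC1 perimeter bdryMoment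
  simp only [pow_one]
  rw [← bdryIntegral_const_mul, ← bdryIntegral_const_mul, ← bdryIntegral_const_mul,
    ← bdryIntegral_add (by fun_prop) (by fun_prop)]
  refine bdryIntegral_congr fun ψ => ?_
  rw [bdry_sq_sub_sq ha, mul_one]

lemma momentC2_eq (ha : 0 < a) : (-1 + a ^ 4) ^ 2 * momentC2 a
    = 4 * a ^ 4 * perimeter a - 4 * a ^ 2 * (1 + a ^ 4) * bdryMoment 1 a
      + (1 + a ^ 4) ^ 2 * bdryMoment 2 a := by
  unfold momentC2 perimeter bdryMoment
  simp only [pow_one]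
  rw [sub_eq_add_neg, ← neg_mul, ← bdryIntegral_const_mul, ← bdryIntegral_const_mul,
    ← bdryIntegral_const_mul, ← bdryIntegral_const_mul,
    ← bdryIntegral_add (by fun_prop) (by fun_prop), ← bdryIntegral_add (by fun_prop) (by fun_prop)]
  refine bdryIntegral_congr fun ψ => ?_
  rw [← mul_pow, bdry_sq_sub_sq ha]
  ring

/-! ### Reduction to complete elliptic integrals -/

lemma integral_cos_sq_quarter {f : ℝ → ℝ} (hf : Continuous fun ψ => f (Real.cos ψ ^ 2)) :
    ∫ ψ in (0 : ℝ)..(2 * Real.pi), f (Real.cos ψ ^ 2)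
      = 4 * ∫ θ in (0 : ℝ)..(Real.pi / 2), f (Real.sin θ ^ 2) := by
  have hi : ∀ x y : ℝ, IntervalIntegrable (fun ψ => f (Real.cos ψ ^ 2)) volume x y :=
    fun x y => hf.intervalIntegrable x y
  have hper : Function.Periodic (fun ψ => f (Real.cos ψ ^ 2)) Real.pi := fun ψ => by simp
  have h1 := hper.intervalIntegral_add_eq 0 Real.pi
  have h2 : ∫ ψ in (0 : ℝ)..(Real.pi / 2), f (Real.cos ψ ^ 2)
      = ∫ θ in (0 : ℝ)..(Real.pi / 2), f (Real.sin θ ^ 2) := by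
    have := intervalIntegral.integral_comp_sub_left
      (fun ψ => f (Real.sin ψ ^ 2)) (Real.pi / 2) (a := 0) (b := Real.pi / 2)
    simpa [Real.sin_pi_div_two_sub] using this
  have h3 : ∫ ψ in (Real.pi / 2)..Real.pi, f (Real.cos ψ ^ 2)
      = ∫ ψ in (0 : ℝ)..(Real.pi / 2), f (Real.cos ψ ^ 2) := by
    have := intervalIntegral.integral_comp_sub_left
      (fun ψ => f (Real.cos ψ ^ 2)) Real.pi (a := Real.pi / 2) (b := Real.pi)
    simpa [Real.cos_pi_sub, show Real.pi - Real.pi / 2 = Real.pi / 2 by ring] using this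
  have h4 := intervalIntegral.integral_add_adjacent_intervals (hi 0 (Real.pi / 2))
    (hi (Real.pi / 2) Real.pi)
  have h5 := intervalIntegral.integral_add_adjacent_intervals (hi 0 Real.pi)
    (hi Real.pi (2 * Real.pi))
  rw [zero_add, ← two_mul] at h1
  linarith

lemma ecc_sq (ha : 1 ≤ a) : ecc a ^ 2 = 1 - 1 / a ^ 4 := by
  refine Real.sq_sqrt (sub_nonneg.2 ?_)
  rw [div_le_one (by positivity)]
  exact one_le_pow₀ ha

lemma speed_eq_ecc (ha : 1 ≤ a) (ψ : ℝ) :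
    speed a ψ = a * √(1 - ecc a ^ 2 * Real.cos ψ ^ 2) := by
  have h0 : 0 < a := by linarith
  rw [← Real.sqrt_sq h0.le, ← Real.sqrt_mul (by positivity), Real.sqrt_sq h0.le, ecc_sq ha]
  unfold speed
  congr 1
  rw [Real.sin_sq]
  field_simp
  ring

lemma perimeter_eq_ellipticE (ha : 1 ≤ a) : perimeter a = 4 * a * ellipticE (ecc a) := by
  rw [perimeter_eq, ellipticE]
  simp only [speed_eq_ecc ha, intervalIntegral.integral_const_mul]
  rw [integral_cos_sq_quarter (f := fun x => √(1 - ecc a ^ 2 * x)) (by fun_prop)]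
  ring

lemma integral_inv_speed_eq_ellipticK (ha : 1 ≤ a) :
    ∫ ψ in (0 : ℝ)..(2 * Real.pi), 1 / speed a ψ = 4 / a * ellipticK (ecc a) := by
  have h0 : 0 < a := by linarith
  rw [ellipticK]
  have hc : Continuous fun ψ => 1 / √(1 - ecc a ^ 2 * Real.cos ψ ^ 2) := by
    refine continuous_const.div (by fun_prop) fun ψ h => ?_
    have := speed_pos h0 ψ
    rw [speed_eq_ecc ha, h, mul_zero] at this
    exact this.false
  have h : ∀ ψ, 1 / speed a ψ = 1 / a * (1 / √(1 - ecc a ^ 2 * Real.cos ψ ^ 2)) := by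
    intro ψ
    rw [speed_eq_ecc ha, one_div_mul_one_div]
  simp only [h, intervalIntegral.integral_const_mul]
  rw [integral_cos_sq_quarter (f := fun x => 1 / √(1 - ecc a ^ 2 * x)) hc]
  ring

/-! ### Interior and boundary means of $x^2-y^2$ -/

lemma integral_cos_sq_two_pi : ∫ ψ in (0 : ℝ)..(2 * Real.pi), Real.cos ψ ^ 2 = Real.pi := by
  rw [integral_cos_sq]
  simp

lemma integral_sin_sq_two_pi : ∫ ψ in (0 : ℝ)..(2 * Real.pi), Real.sin ψ ^ 2 = Real.pi := by
  rw [integral_sin_sq]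
  simp

lemma integral_speed_sq (a : ℝ) :
    ∫ ψ in (0 : ℝ)..(2 * Real.pi), speed a ψ ^ 2 = Real.pi * (a ^ 2 + 1 / a ^ 2) := by
  simp only [speed_sq]
  rw [intervalIntegral.integral_add, intervalIntegral.integral_const_mul,
    intervalIntegral.integral_div, integral_cos_sq_two_pi, integral_sin_sq_two_pi]
  · ring
  all_goals exact Continuous.intervalIntegrable (by fun_prop) _ _

/-- Here $r$ is the root mean square of $s$ over $\psi$; integrate $s\le s^2/(2r)+r/2$. -/
lemma perimeter_le {r : ℝ} (hr : 0 < r) (hS : a ^ 2 + 1 / a ^ 2 = 2 * r ^ 2) :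
    perimeter a ≤ 2 * Real.pi * r := by
  rw [perimeter_eq]
  have h : ∫ ψ in (0 : ℝ)..(2 * Real.pi), speed a ψ
      ≤ ∫ ψ in (0 : ℝ)..(2 * Real.pi), (1 / (2 * r) * speed a ψ ^ 2 + r / 2) := by
    refine intervalIntegral.integral_mono (by positivity)
      (Continuous.intervalIntegrable (by fun_prop) _ _)
      (Continuous.intervalIntegrable (by fun_prop) _ _) fun ψ => ?_
    have : 1 / (2 * r) * speed a ψ ^ 2 + r / 2 - speed a ψ
        = (speed a ψ - r) ^ 2 / (2 * r) := by field_simp; ring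
    have h2 : 0 ≤ (speed a ψ - r) ^ 2 / (2 * r) := by positivity
    linarith
  refine h.trans_eq ?_
  rw [intervalIntegral.integral_add, intervalIntegral.integral_const_mul, integral_speed_sq, hS,
    intervalIntegral.integral_const, smul_eq_mul]
  · field_simp
    ring
  all_goals exact Continuous.intervalIntegrable (by fun_prop) _ _

/-- The function $z\mapsto z^{-1/2}$ lies above its tangent at $z=r^2$; integrate this with $z=s^2$.
-/
lemma le_integral_inv_speed (ha : 0 < a) {r : ℝ} (hr : 0 < r)
    (hS : a ^ 2 + 1 / a ^ 2 = 2 * r ^ 2) :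
    2 * Real.pi / r ≤ ∫ ψ in (0 : ℝ)..(2 * Real.pi), 1 / speed a ψ := by
  have hc : Continuous fun ψ => 1 / speed a ψ :=
    continuous_const.div (continuous_speed a) fun ψ => (speed_pos ha ψ).ne'
  have h : ∫ ψ in (0 : ℝ)..(2 * Real.pi), (-(1 / (2 * r ^ 3)) * speed a ψ ^ 2 + 3 / (2 * r))
      ≤ ∫ ψ in (0 : ℝ)..(2 * Real.pi), 1 / speed a ψ := by
    refine intervalIntegral.integral_mono (by positivity)
      (Continuous.intervalIntegrable (by fun_prop) _ _)
      (hc.intervalIntegrable _ _) fun ψ => ?_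
    have hp := speed_pos ha ψ
    have : 1 / speed a ψ - (-(1 / (2 * r ^ 3)) * speed a ψ ^ 2 + 3 / (2 * r))
        = (speed a ψ - r) ^ 2 * (speed a ψ + 2 * r) / (2 * r ^ 3 * speed a ψ) := by
      field_simp
      ring
    have h2 : 0 ≤ (speed a ψ - r) ^ 2 * (speed a ψ + 2 * r) / (2 * r ^ 3 * speed a ψ) := by
      positivity
    dsimp only
    linarith
  refine le_trans (le_of_eq ?_) h
  rw [intervalIntegral.integral_add, intervalIntegral.integral_const_mul, integral_speed_sq, hS,
    intervalIntegral.integral_const, smul_eq_mul]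
  · field_simp
    ring
  all_goals exact Continuous.intervalIntegrable (by fun_prop) _ _

/-- The mean of `x² - y²` over the boundary exceeds its mean over the ellipse. -/
lemma mean_lt_boundary_mean (ha : 1 < a) :
    -1 + a ^ 4 - 4 * a ^ 2 * (momentC1 a / perimeter a) < 0 := by
  have h0 : 0 < a := by linarith
  have hP := perimeter_pos h0
  have ha4 : 0 < -1 + a ^ 4 := by
    have := one_lt_pow₀ ha (n := 4) (by norm_num)
    linarith
  have hC := momentC1_eq h0
  rw [bdryMoment_one_eq h0] at hC
  set S := a ^ 2 + 1 / a ^ 2 with hSdef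
  have hS0 : 0 < S := by positivity
  obtain ⟨r, hr, hS⟩ : ∃ r : ℝ, 0 < r ∧ S = 2 * r ^ 2 :=
    ⟨√(S / 2), Real.sqrt_pos.2 (by positivity), by rw [Real.sq_sqrt (by positivity)]; ring⟩
  have hP2 := perimeter_le hr hS
  have hK := le_integral_inv_speed h0 hr hS
  set K := ∫ ψ in (0 : ℝ)..(2 * Real.pi), 1 / speed a ψ
  have haS : 1 + a ^ 4 = a ^ 2 * S := by rw [hSdef]; field_simp; ring
  have hr4 : 1 < r ^ 4 := by
    have h1 : 4 * a ^ 4 < (1 + a ^ 4) ^ 2 := by nlinarith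
    rw [haS, hS] at h1
    have h2 : 0 < a ^ 4 * (r ^ 4 - 1) := by linarith
    have := pos_of_mul_pos_right h2 (by positivity)
    linarith
  have hpos : 0 < perimeter a * (4 * r ^ 4 - 12) + 8 * r ^ 2 * K := by
    have hK0 : 16 * Real.pi * r ≤ 8 * r ^ 2 * K := by
      have := mul_le_mul_of_nonneg_left hK (by positivity : 0 ≤ 8 * r ^ 2)
      refine le_trans (le_of_eq ?_) this
      field_simp
      norm_num
    have hpr : 0 < Real.pi * r := mul_pos Real.pi_pos hr
    -- If the coefficient of $P$ is negative, $P\le2\pi r$ bounds the sum below by $8\pi r(r^4-1)$,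
    -- which is positive as $r^4>1$.
    by_cases hc : 0 ≤ 4 * r ^ 4 - 12
    · nlinarith [mul_nonneg hP.le hc]
    · nlinarith [mul_le_mul_of_nonpos_right hP2 (le_of_not_ge hc), mul_pos hpr (sub_pos.2 hr4)]
  have hsq : (-1 + a ^ 4) ^ 2 = a ^ 4 * (S ^ 2 - 4) := by
    have : (-1 + a ^ 4) ^ 2 = (1 + a ^ 4) ^ 2 - 4 * a ^ 4 := by ring
    rw [this, haS]
    ring
  have key : (-1 + a ^ 4) * perimeter a - 4 * a ^ 2 * momentC1 a < 0 := by
    have h1 : (-1 + a ^ 4) * ((-1 + a ^ 4) * perimeter a - 4 * a ^ 2 * momentC1 a)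
        = -(a ^ 4 / 3 * (perimeter a * (4 * r ^ 4 - 12) + 8 * r ^ 2 * K)) := by
      rw [haS] at hC
      rw [hS] at hC hsq
      linear_combination perimeter a * hsq - 4 * a ^ 2 * hC
    have h2 : 0 < a ^ 4 / 3 * (perimeter a * (4 * r ^ 4 - 12) + 8 * r ^ 2 * K) := by positivity
    by_contra hcon
    nlinarith [mul_nonneg ha4.le (not_lt.1 hcon)]
  have : -1 + a ^ 4 - 4 * a ^ 2 * (momentC1 a / perimeter a)
      = ((-1 + a ^ 4) * perimeter a - 4 * a ^ 2 * momentC1 a) / perimeter a := by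
    field_simp
  rw [this]
  exact div_neg_of_neg_of_pos key hP

/-! ### Quadratics on the ellipse -/

lemma integral_cos_four_two_pi :
    ∫ ψ in (0 : ℝ)..(2 * Real.pi), Real.cos ψ ^ 4 = 3 / 4 * Real.pi := by
  rw [integral_cos_pow 2, integral_cos_sq_two_pi]
  norm_num

lemma integral_sin_four_two_pi :
    ∫ ψ in (0 : ℝ)..(2 * Real.pi), Real.sin ψ ^ 4 = 3 / 4 * Real.pi := by
  rw [integral_sin_pow 2, integral_sin_sq_two_pi]
  norm_num

lemma hasFDerivAt_comp_fst {f : ℝ → ℝ} {f' : ℝ} {p : ℝ × ℝ} (h : HasDerivAt f f' p.1) :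
    HasFDerivAt (fun p : ℝ × ℝ => f p.1) (f' • ContinuousLinearMap.fst ℝ ℝ ℝ) p :=
  h.comp_hasFDerivAt p hasFDerivAt_fst

lemma hasFDerivAt_comp_snd {f : ℝ → ℝ} {f' : ℝ} {p : ℝ × ℝ} (h : HasDerivAt f f' p.2) :
    HasFDerivAt (fun p : ℝ × ℝ => f p.2) (f' • ContinuousLinearMap.snd ℝ ℝ ℝ) p :=
  h.comp_hasFDerivAt p hasFDerivAt_snd

lemma setIntegral_ellipse_one (ha : 0 < a) : ∫ _ in ellipse a, (1 : ℝ) = Real.pi := by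
  have h := divergence_theorem_ellipse ha (F₁ := fun p => p.1) (F₂ := fun _ => 0)
    (d := fun _ => 1) (F₁' := fun _ => ContinuousLinearMap.fst ℝ ℝ ℝ) (F₂' := fun _ => 0)
    (by fun_prop) (by fun_prop) (by fun_prop) (fun p _ => hasFDerivAt_fst)
    (fun p _ => hasFDerivAt_const _ _) (fun p _ => by simp)
  rw [h]
  refine Eq.trans ?_ integral_cos_sq_two_pi
  refine intervalIntegral.integral_congr fun ψ _ => ?_
  simp only [bdry]
  field_simp
  ring

lemma setIntegral_ellipse_fst_sq (ha : 0 < a) :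
    ∫ p in ellipse a, p.1 ^ 2 = Real.pi * a ^ 2 / 4 := by
  have hd : ∀ x : ℝ, HasDerivAt (fun x : ℝ => x ^ 3 / 3) (x ^ 2) x := fun x =>
    ((hasDerivAt_pow 3 x).div_const 3).congr_deriv (by push_cast; ring)
  rw [divergence_theorem_ellipse ha (F₁ := fun p => p.1 ^ 3 / 3) (F₂ := fun _ => 0)
    (F₁' := fun p => p.1 ^ 2 • ContinuousLinearMap.fst ℝ ℝ ℝ) (F₂' := fun _ => 0)
    (by fun_prop) (by fun_prop) (by fun_prop) (fun p _ => hasFDerivAt_comp_fst (hd p.1))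
    (fun p _ => hasFDerivAt_const _ _) (fun p _ => by simp),
    show Real.pi * a ^ 2 / 4 = a ^ 2 / 3 * (3 / 4 * Real.pi) by ring,
    ← integral_cos_four_two_pi, ← intervalIntegral.integral_const_mul]
  refine intervalIntegral.integral_congr fun ψ _ => ?_
  simp only [bdry]
  field_simp
  ring

lemma setIntegral_ellipse_snd_sq (ha : 0 < a) :
    ∫ p in ellipse a, p.2 ^ 2 = Real.pi / (4 * a ^ 2) := by
  have hd : ∀ x : ℝ, HasDerivAt (fun x : ℝ => x ^ 3 / 3) (x ^ 2) x := fun x =>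
    ((hasDerivAt_pow 3 x).div_const 3).congr_deriv (by push_cast; ring)
  rw [divergence_theorem_ellipse ha (F₁ := fun _ => 0) (F₂ := fun p => p.2 ^ 3 / 3)
    (F₁' := fun _ => 0) (F₂' := fun p => p.2 ^ 2 • ContinuousLinearMap.snd ℝ ℝ ℝ)
    (by fun_prop) (by fun_prop) (by fun_prop) (fun p _ => hasFDerivAt_const _ _)
    (fun p _ => hasFDerivAt_comp_snd (hd p.2)) (fun p _ => by simp),
    show Real.pi / (4 * a ^ 2) = 1 / (3 * a ^ 2) * (3 / 4 * Real.pi) by field_simp,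
    ← integral_sin_four_two_pi, ← intervalIntegral.integral_const_mul]
  refine intervalIntegral.integral_congr fun ψ _ => ?_
  simp only [bdry]
  field_simp
  ring

lemma area_eq_pi (ha : 0 < a) : area a = Real.pi := by
  rw [← setIntegral_ellipse_one ha, setIntegral_const, smul_eq_mul, mul_one]
  rfl

lemma setIntegral_vQuad (ha : 0 < a) (q : ℝ × ℝ × ℝ) :
    ∫ p in ellipse a, vQuad q p
      = q.1 * Real.pi + (q.2.1 * a ^ 2 + q.2.2 / a ^ 2) * (Real.pi / 4) := by
  have h1 : IntegrableOn (fun _ : ℝ × ℝ => q.1) (ellipse a) :=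
    integrableOn_ellipse ha continuousOn_const
  have h2 : IntegrableOn (fun p : ℝ × ℝ => q.2.1 * p.1 ^ 2) (ellipse a) :=
    integrableOn_ellipse ha (by fun_prop)
  have h3 : IntegrableOn (fun p : ℝ × ℝ => q.2.2 * p.2 ^ 2) (ellipse a) :=
    integrableOn_ellipse ha (by fun_prop)
  have h : ∫ _ in ellipse a, q.1 = q.1 * Real.pi := by
    rw [← setIntegral_ellipse_one ha, ← integral_const_mul, mul_one]
  unfold vQuad
  have h12 : IntegrableOn (fun p : ℝ × ℝ => q.1 + q.2.1 * p.1 ^ 2) (ellipse a) := h1.add h2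
  rw [integral_add h12 h3, integral_add h1 h2, integral_const_mul, integral_const_mul,
    setIntegral_ellipse_fst_sq ha, setIntegral_ellipse_snd_sq ha, h]
  field_simp
  ring

lemma hasFDerivAt_vQuad (q : ℝ × ℝ × ℝ) (p : ℝ × ℝ) :
    HasFDerivAt (vQuad q) ((2 * q.2.1 * p.1) • ContinuousLinearMap.fst ℝ ℝ ℝ
      + (2 * q.2.2 * p.2) • ContinuousLinearMap.snd ℝ ℝ ℝ) p := by
  have hd : ∀ c x : ℝ, HasDerivAt (fun x : ℝ => c * x ^ 2) (2 * c * x) x := fun c x =>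
    ((hasDerivAt_pow 2 x).const_mul c).congr_deriv (by push_cast; ring)
  have h := ((hasFDerivAt_const q.1 p).add (hasFDerivAt_comp_fst (hd q.2.1 p.1))).add
    (hasFDerivAt_comp_snd (hd q.2.2 p.2))
  rw [zero_add] at h
  exact h

lemma dx_vQuad (q : ℝ × ℝ × ℝ) : dx (vQuad q) = fun p => 2 * q.2.1 * p.1 := by
  ext p
  simp [dx, (hasFDerivAt_vQuad q p).fderiv]

lemma dy_vQuad (q : ℝ × ℝ × ℝ) : dy (vQuad q) = fun p => 2 * q.2.2 * p.2 := by
  ext p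
  simp [dy, (hasFDerivAt_vQuad q p).fderiv]

lemma laplacian_vQuad (q : ℝ × ℝ × ℝ) (p : ℝ × ℝ) :
    laplacian (vQuad q) p = 2 * q.2.1 + 2 * q.2.2 := by
  have h1 : HasFDerivAt (fun p : ℝ × ℝ => 2 * q.2.1 * p.1)
    ((2 * q.2.1) • ContinuousLinearMap.fst ℝ ℝ ℝ) p := hasFDerivAt_fst.const_mul _
  have h2 : HasFDerivAt (fun p : ℝ × ℝ => 2 * q.2.2 * p.2)
    ((2 * q.2.2) • ContinuousLinearMap.snd ℝ ℝ ℝ) p := hasFDerivAt_snd.const_mul _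
  rw [laplacian, dx_vQuad, dy_vQuad, dx, dy, h1.fderiv, h2.fderiv]
  simp

/-- The gradient of a quadratic. -/
def gradQuad (q : ℝ × ℝ × ℝ) (p : ℝ × ℝ) : ℝ × ℝ := (2 * q.2.1 * p.1, 2 * q.2.2 * p.2)

lemma isC2C1_vQuad (a : ℝ) (q : ℝ × ℝ × ℝ) : IsC2C1 a (vQuad q) (gradQuad q) where
  contDiffOn := by unfold vQuad; fun_prop
  continuousOn := by unfold vQuad; fun_prop
  grad_continuousOn := by unfold gradQuad; fun_prop
  grad_eq p _ := by simp only [dx_vQuad, dy_vQuad, gradQuad]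

lemma setIntegral_gradSq_vQuad (ha : 0 < a) (q : ℝ × ℝ × ℝ) :
    ∫ p in ellipse a, gradSq (vQuad q) p
      = Real.pi * (q.2.1 ^ 2 * a ^ 2 + q.2.2 ^ 2 / a ^ 2) := by
  have h : gradSq (vQuad q) = vQuad (0, 4 * q.2.1 ^ 2, 4 * q.2.2 ^ 2) := by
    ext p
    simp only [gradSq, dx_vQuad, dy_vQuad, vQuad]
    ring
  rw [h, setIntegral_vQuad ha]
  ring

lemma functionalA_vQuad (ha : 0 < a) (q : ℝ × ℝ × ℝ) :
    functionalA a (vQuad q) = 2 * (∫ p in ellipse a, vQuad q p)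
      - ∫ p in ellipse a, gradSq (vQuad q) p := by
  unfold functionalA
  rw [integral_sub, integral_const_mul]
  · exact (integrableOn_ellipse ha (isC2C1_vQuad a q).continuousOn).const_mul 2
  · refine integrableOn_ellipse ha ?_
    unfold gradSq
    rw [dx_vQuad, dy_vQuad]
    fun_prop

/-- The coefficients of `l u₀ + t (x² - y² - C₁ / P) + c`. -/
noncomputable def quadOf (a l t c : ℝ) : ℝ × ℝ × ℝ :=
  (l * (a ^ 2 / (2 * (1 + a ^ 4))) - t * (momentC1 a / perimeter a) + c,
    -(l / (2 * (1 + a ^ 4))) + t, -(l * a ^ 4 / (2 * (1 + a ^ 4))) - t)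

lemma vQuad_quadOf (ha : 0 < a) (l t c : ℝ) (p : ℝ × ℝ) :
    vQuad (quadOf a l t c) p
      = l * u0 a p + t * (p.1 ^ 2 - p.2 ^ 2 - momentC1 a / perimeter a) + c := by
  simp only [vQuad, quadOf, u0]
  have : (1 + a ^ 4) ≠ 0 := by positivity
  field_simp
  ring

lemma testFun_eq_vQuad (ha : 0 < a) (t : ℝ) : testFun a t = vQuad (quadOf a 1 t 0) := by
  ext p
  rw [vQuad_quadOf ha, testFun]
  ring

lemma u0_eq_vQuad (ha : 0 < a) : u0 a = vQuad (quadOf a 1 0 0) := by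
  ext p
  rw [vQuad_quadOf ha]
  ring

lemma exists_eq_quadOf (a : ℝ) (q : ℝ × ℝ × ℝ) : ∃ l t c, q = quadOf a l t c := by
  obtain ⟨c0, cx, cy⟩ := q
  -- The Laplacian $2(c_x+c_y)$ must equal $-l$, because $x^2-y^2$ is harmonic; then the $x^2$
  -- coefficient gives $t$ and the constant term gives $c$.
  refine ⟨-2 * (cx + cy), cx + -2 * (cx + cy) / (2 * (1 + a ^ 4)),
    c0 - -2 * (cx + cy) * (a ^ 2 / (2 * (1 + a ^ 4)))
      + (cx + -2 * (cx + cy) / (2 * (1 + a ^ 4))) * (momentC1 a / perimeter a), ?_⟩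
  have : (1 + a ^ 4) ≠ 0 := by positivity
  simp only [quadOf, Prod.mk.injEq]
  refine ⟨by ring, by ring, ?_⟩
  field_simp
  ring

lemma u0_bdry (ha : 0 < a) (ψ : ℝ) : u0 a (bdry a ψ) = 0 := by
  have h := bdry_mem_boundary ha ψ
  rw [u0, show 1 - (bdry a ψ).1 ^ 2 / a ^ 2 - a ^ 2 * (bdry a ψ).2 ^ 2 = 0 by linarith, zero_div]

lemma solvesSlip_u0 (ha : 0 < a) : SolvesSlip a 0 (u0 a) := by
  refine ⟨gradQuad (quadOf a 1 0 0), ?_, fun p _ => ?_, fun ψ => ?_⟩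
  · rw [u0_eq_vQuad ha]
    exact isC2C1_vQuad a _
  · rw [u0_eq_vQuad ha, laplacian_vQuad]
    have : (1 + a ^ 4) ≠ 0 := by positivity
    simp only [quadOf]
    field_simp
    ring
  · rw [u0_bdry ha, zero_mul, add_zero]

lemma bdryIntegral_const (a c : ℝ) : bdryIntegral a (fun _ => c) = c * perimeter a := by
  have h := bdryIntegral_const_mul (a := a) c (fun _ => 1)
  simp only [mul_one] at h
  exact h

lemma bdryIntegral_testFun (ha : 0 < a) (t : ℝ) : bdryIntegral a (testFun a t) = 0 := by
  have h : bdryIntegral a (testFun a t) = bdryIntegral a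
      (fun p => t * (p.1 ^ 2 - p.2 ^ 2) + -(t * (momentC1 a / perimeter a))) := by
    refine bdryIntegral_congr fun ψ => ?_
    rw [testFun, u0_bdry ha]
    ring
  rw [h, bdryIntegral_add (by fun_prop) (by fun_prop), bdryIntegral_const_mul, bdryIntegral_const]
  have := (perimeter_pos ha).ne'
  change t * momentC1 a + _ = 0
  field_simp
  ring

lemma functionalB_quadOf (ha : 0 < a) (l t c : ℝ) :
    functionalB a (vQuad (quadOf a l t c))
      = t ^ 2 * (momentC2 a - momentC1 a ^ 2 / perimeter a) + c ^ 2 * perimeter a := by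
  have h : functionalB a (vQuad (quadOf a l t c)) = bdryIntegral a
      (fun p => (t ^ 2 * (p.1 ^ 2 - p.2 ^ 2) ^ 2
        + (2 * t * (c - t * (momentC1 a / perimeter a))) * (p.1 ^ 2 - p.2 ^ 2))
        + (c - t * (momentC1 a / perimeter a)) ^ 2) := by
    refine bdryIntegral_congr fun ψ => ?_
    rw [vQuad_quadOf ha, u0_bdry ha]
    ring
  rw [h, bdryIntegral_add (by fun_prop) (by fun_prop),
    bdryIntegral_add (by fun_prop) (by fun_prop), bdryIntegral_const_mul, bdryIntegral_const_mul,
    bdryIntegral_const]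
  have := (perimeter_pos ha).ne'
  change t ^ 2 * momentC2 a + _ * momentC1 a + _ = _
  field_simp
  ring

/-- This quantity is $\oint(x^2-y^2-C_1/P)^2\,ds$. -/
lemma boundaryVariance_nonneg (ha : 0 < a) :
    0 ≤ momentC2 a - momentC1 a ^ 2 / perimeter a := by
  have h := functionalB_quadOf ha 0 1 0
  have h0 : 0 ≤ functionalB a (vQuad (quadOf a 0 1 0)) :=
    intervalIntegral.integral_nonneg (by positivity)
      fun ψ _ => mul_nonneg (sq_nonneg _) (speed_pos ha ψ).le
  rw [h] at h0
  linarith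

/-- The coefficient of $t$ is $\pi$ times the interior mean minus the boundary mean of $x^2-y^2$. -/
lemma setIntegral_quadOf (ha : 0 < a) (l t c : ℝ) :
    ∫ p in ellipse a, vQuad (quadOf a l t c) p = l * (Real.pi * a ^ 2 / (4 * (1 + a ^ 4)))
      + t * (Real.pi * (-1 + a ^ 4 - 4 * a ^ 2 * (momentC1 a / perimeter a)) / (4 * a ^ 2))
      + c * Real.pi := by
  rw [setIntegral_vQuad ha]
  generalize hk : momentC1 a / perimeter a = k
  simp only [quadOf, hk]
  have : (1 + a ^ 4) ≠ 0 := by positivity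
  field_simp
  ring

/-- No $lt$ term appears: $u_0$ vanishes on $\partial\Omega$ and $x^2-y^2$ is harmonic, so their
gradients are orthogonal in $L^2(\Omega)$. -/
lemma setIntegral_gradSq_quadOf (ha : 0 < a) (l t c : ℝ) :
    ∫ p in ellipse a, gradSq (vQuad (quadOf a l t c)) p
      = l ^ 2 * (Real.pi * a ^ 2 / (4 * (1 + a ^ 4)))
        + t ^ 2 * (Real.pi * (1 + a ^ 4) / a ^ 2) := by
  rw [setIntegral_gradSq_vQuad ha]
  simp only [quadOf]
  have : (1 + a ^ 4) ≠ 0 := by positivity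
  field_simp
  ring

/-! ### The optimal test function and the constants of $R_a$ -/

lemma torsionalRigidity_eq (ha : 0 < a) :
    torsionalRigidity a = Real.pi * a ^ 2 / (4 * (1 + a ^ 4)) := by
  rw [torsionalRigidity, u0_eq_vQuad ha, setIntegral_quadOf ha]
  ring

lemma functionalA_testFun (ha : 0 < a) (t : ℝ) :
    functionalA a (testFun a t) = -(Real.pi * (4 * (1 + a ^ 4) ^ 2 * t ^ 2
      - 2 * (1 + a ^ 4) * (-1 + a ^ 4 - 4 * a ^ 2 * (momentC1 a / perimeter a)) * t - a ^ 4))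
        / (4 * a ^ 2 * (1 + a ^ 4)) := by
  rw [testFun_eq_vQuad ha, functionalA_vQuad ha, setIntegral_quadOf ha,
    setIntegral_gradSq_quadOf ha]
  generalize momentC1 a / perimeter a = k
  have : (1 + a ^ 4) ≠ 0 := by positivity
  field_simp
  ring

lemma functionalA_testFun_lt (ha : 0 < a) {t : ℝ} (ht : t ≠ tStar a) :
    functionalA a (testFun a t) < functionalA a (vStar a) := by
  have h : functionalA a (vStar a) - functionalA a (testFun a t)
      = Real.pi * (1 + a ^ 4) / a ^ 2 * (t - tStar a) ^ 2 := by
    rw [vStar, functionalA_testFun ha, functionalA_testFun ha, tStar]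
    generalize momentC1 a / perimeter a = k
    have : (1 + a ^ 4) ≠ 0 := by positivity
    field_simp
    ring
  have h0 : 0 < Real.pi * (1 + a ^ 4) / a ^ 2 * (t - tStar a) ^ 2 := by
    have := sub_ne_zero.2 ht
    positivity
  linarith

lemma sigmaAInf_eq (ha : 0 < a) : sigmaAInf a = Real.pi * (a ^ 4 + 1 / 4 * (-1 + a ^ 4
    - 4 * a ^ 2 * (momentC1 a / perimeter a)) ^ 2) / (4 * a ^ 2 * (1 + a ^ 4)) := by
  rw [sigmaAInf, vStar, testFun_eq_vQuad ha, setIntegral_quadOf ha, tStar]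
  generalize momentC1 a / perimeter a = k
  have : (1 + a ^ 4) ≠ 0 := by positivity
  field_simp
  ring

lemma sigmaAInf_eq_functionalA (ha : 0 < a) : sigmaAInf a = functionalA a (vStar a) := by
  rw [sigmaAInf_eq ha, vStar, functionalA_testFun ha, tStar]
  generalize momentC1 a / perimeter a = k
  have : (1 + a ^ 4) ≠ 0 := by positivity
  field_simp
  ring

lemma sigmaAInf_eq_setIntegral_gradSq (ha : 0 < a) :
    sigmaAInf a = ∫ p in ellipse a, gradSq (vStar a) p := by
  rw [sigmaAInf_eq ha, vStar, testFun_eq_vQuad ha, setIntegral_gradSq_quadOf ha, tStar]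
  generalize momentC1 a / perimeter a = k
  have : (1 + a ^ 4) ≠ 0 := by positivity
  field_simp

lemma functionalB_testFun (ha : 0 < a) (t : ℝ) :
    functionalB a (testFun a t)
      = t ^ 2 * (momentC2 a - momentC1 a ^ 2 / perimeter a) := by
  rw [testFun_eq_vQuad ha, functionalB_quadOf ha]
  ring

lemma sigmaAOne_eq_tStar (ha : 0 < a) :
    sigmaAOne a = -(tStar a ^ 2 * (momentC2 a - momentC1 a ^ 2 / perimeter a)) := by
  rw [← functionalB_testFun ha]
  rfl

lemma sigmaAOne_eq (ha : 0 < a) :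
    sigmaAOne a = -((-4 * a ^ 2 * (momentC1 a / perimeter a) + a ^ 4 - 1) ^ 2
      * (momentC2 a - momentC1 a ^ 2 / perimeter a) / (16 * (a ^ 4 + 1) ^ 2)) := by
  rw [sigmaAOne_eq_tStar ha, tStar]
  have : (1 + a ^ 4) ≠ 0 := by positivity
  rw [add_comm (a ^ 4) 1]
  generalize momentC2 a - momentC1 a ^ 2 / perimeter a = V
  generalize momentC1 a / perimeter a = k
  field_simp
  ring

lemma sigmaAInf_sub (ha : 0 < a) : sigmaAInf a - torsionalRigidity a
    = Real.pi * (1 + a ^ 4) / a ^ 2 * tStar a ^ 2 := by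
  rw [sigmaAInf_eq ha, torsionalRigidity_eq ha, tStar]
  generalize momentC1 a / perimeter a = k
  have : (1 + a ^ 4) ≠ 0 := by positivity
  field_simp
  ring

lemma tStar_neg (ha : 1 < a) : tStar a < 0 :=
  div_neg_of_neg_of_pos (mean_lt_boundary_mean ha) (by positivity)

lemma boundRa_denominator_pos (ha : 1 < a) {β : ℝ} (hβ : 0 < β) :
    0 < β * (sigmaAInf a - torsionalRigidity a) - sigmaAOne a := by
  have h0 : 0 < a := by linarith
  have hV := boundaryVariance_nonneg h0
  have ht : 0 < tStar a ^ 2 := by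
    have := (tStar_neg ha).ne
    positivity
  rw [sigmaAInf_sub h0, sigmaAOne_eq_tStar h0, sub_neg_eq_add]
  have := mul_nonneg ht.le hV
  positivity

/-! ### The best quadratic and the lower bound -/

/-- The curvature of `t ↦ -𝒥 (v_t)`. -/
noncomputable def curvatureJ (a β : ℝ) : ℝ :=
  Real.pi * (1 + a ^ 4) / a ^ 2 + (momentC2 a - momentC1 a ^ 2 / perimeter a) / β

lemma curvatureJ_pos (ha : 0 < a) {β : ℝ} (hβ : 0 < β) : 0 < curvatureJ a β := by
  have hV := div_nonneg (boundaryVariance_nonneg ha) hβ.le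
  have : 0 < Real.pi * (1 + a ^ 4) / a ^ 2 := by positivity
  exact add_pos_of_pos_of_nonneg this hV

/-- The coordinate along `x² - y² - C₁ / P` of the maximiser of `𝒥`. -/
noncomputable def tBest (a β : ℝ) : ℝ :=
  Real.pi * (1 + a ^ 4) / a ^ 2 * tStar a / curvatureJ a β

lemma boundRa_eq (ha : 0 < a) {β : ℝ} (hβ : 0 < β) :
    boundRa a β = torsionalRigidity a + β * (Real.pi ^ 2 / perimeter a)
      + curvatureJ a β * tBest a β ^ 2 := by
  rw [boundRa, boundR, area_eq_pi ha, sigmaAInf_sub ha, sigmaAOne_eq_tStar ha]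
  congr 1
  have hK := curvatureJ_pos ha hβ
  have hden : β * (Real.pi * (1 + a ^ 4) / a ^ 2 * tStar a ^ 2)
      - -(tStar a ^ 2 * (momentC2 a - momentC1 a ^ 2 / perimeter a))
      = β * tStar a ^ 2 * curvatureJ a β := by
    rw [curvatureJ]
    field_simp
    ring
  rw [hden, tBest]
  -- When $t_*=0$ the fraction is $0/0$, which Lean evaluates to $0$, and `tBest` is $0$ too; this
  -- covers the convention for $a=1$.
  rcases eq_or_ne (tStar a) 0 with h | h
  · simp [h]
  · generalize curvatureJ a β = K at *
    field_simp

/-- Since $\mathcal J$ has no cross terms in $l,t,c$, each square is completed separately. The three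
maxima add up to $R_a(\beta)$, and the strictly positive weights give uniqueness. -/
lemma functionalJ_quadOf (ha : 0 < a) {β : ℝ} (hβ : 0 < β) (l t c : ℝ) :
    functionalJ a β (vQuad (quadOf a l t c)) = boundRa a β
      - (torsionalRigidity a * (l - 1) ^ 2 + curvatureJ a β * (t - tBest a β) ^ 2
        + perimeter a / β * (c - β * Real.pi / perimeter a) ^ 2) := by
  have hK := (curvatureJ_pos ha hβ).ne'
  have hP := (perimeter_pos ha).ne'
  have h1 : (1 + a ^ 4) ≠ 0 := by positivity
  have hT : curvatureJ a β * tBest a β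
      = Real.pi * (-1 + a ^ 4 - 4 * a ^ 2 * (momentC1 a / perimeter a)) / (4 * a ^ 2) := by
    rw [tBest, mul_div_cancel₀ _ hK, tStar]
    field_simp
  rw [functionalJ, functionalA_vQuad ha, functionalB_quadOf ha, setIntegral_quadOf ha,
    setIntegral_gradSq_quadOf ha, boundRa_eq ha hβ, torsionalRigidity_eq ha, ← hT]
  have e : curvatureJ a β = Real.pi * (1 + a ^ 4) / a ^ 2
    + (momentC2 a - momentC1 a ^ 2 / perimeter a) / β := rfl
  have e2 : perimeter a / β * (c - β * Real.pi / perimeter a) ^ 2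
      = perimeter a / β * c ^ 2 - 2 * c * Real.pi + β * (Real.pi ^ 2 / perimeter a) := by
    field_simp
    ring
  rw [e2]
  linear_combination t ^ 2 * e

lemma isBestQuad_iff (ha : 0 < a) {β : ℝ} (hβ : 0 < β) (q : ℝ × ℝ × ℝ) :
    IsBestQuad a β q ↔ q = quadOf a 1 (tBest a β) (β * Real.pi / perimeter a) := by
  have hK := curvatureJ_pos ha hβ
  have hP := perimeter_pos ha
  have hQ : 0 < torsionalRigidity a := by
    rw [torsionalRigidity_eq ha]
    positivity
  constructor
  · intro h
    have h1 := h (quadOf a 1 (tBest a β) (β * Real.pi / perimeter a))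
    obtain ⟨l, t, c, rfl⟩ := exists_eq_quadOf a q
    rw [functionalJ_quadOf ha hβ, functionalJ_quadOf ha hβ] at h1
    simp only [sub_self, ne_eq, OfNat.ofNat_ne_zero, not_false_eq_true, zero_pow, mul_zero,
      add_zero, sub_zero] at h1
    have n1 : 0 ≤ torsionalRigidity a * (l - 1) ^ 2 := by positivity
    have n2 : 0 ≤ curvatureJ a β * (t - tBest a β) ^ 2 := by positivity
    have n3 : 0 ≤ perimeter a / β * (c - β * Real.pi / perimeter a) ^ 2 := by positivity
    have z1 : torsionalRigidity a * (l - 1) ^ 2 = 0 := by linarith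
    have z2 : curvatureJ a β * (t - tBest a β) ^ 2 = 0 := by linarith
    have z3 : perimeter a / β * (c - β * Real.pi / perimeter a) ^ 2 = 0 := by linarith
    have hPβ : perimeter a / β ≠ 0 := by positivity
    simp only [mul_eq_zero, hQ.ne', hK.ne', hPβ, false_or, pow_eq_zero_iff, ne_eq,
      OfNat.ofNat_ne_zero, not_false_eq_true, sub_eq_zero] at z1 z2 z3
    rw [z1, z2, z3]
  · rintro rfl q
    obtain ⟨l, t, c, rfl⟩ := exists_eq_quadOf a q
    rw [functionalJ_quadOf ha hβ, functionalJ_quadOf ha hβ]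
    simp only [sub_self, ne_eq, OfNat.ofNat_ne_zero, not_false_eq_true, zero_pow, mul_zero,
      add_zero, sub_zero]
    have : 0 ≤ torsionalRigidity a * (l - 1) ^ 2 + curvatureJ a β * (t - tBest a β) ^ 2
        + perimeter a / β * (c - β * Real.pi / perimeter a) ^ 2 := by positivity
    linarith

lemma functionalJ_of_isBestQuad (ha : 0 < a) {β : ℝ} (hβ : 0 < β) {q : ℝ × ℝ × ℝ}
    (hq : IsBestQuad a β q) : functionalJ a β (vQuad q) = boundRa a β := by
  rw [(isBestQuad_iff ha hβ q).1 hq, functionalJ_quadOf ha hβ]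
  ring

lemma boundRa_le (ha : 0 < a) {β : ℝ} (hβ : 0 < β) {u : ℝ × ℝ → ℝ} (hu : SolvesSlip a β u) :
    boundRa a β ≤ ∫ p in ellipse a, u p := by
  rw [← functionalJ_of_isBestQuad ha hβ ((isBestQuad_iff ha hβ _).2 rfl)]
  exact functionalJ_le_of_solvesSlip ha hβ hu (isC2C1_vQuad a _)

/-! ### Strictness of $\Sigma_{a,\infty}\le\Sigma_\infty$ off the disk -/

lemma eq_one_of_normalComp_gradQuad_const (ha : 0 < a) {q : ℝ × ℝ × ℝ} {k : ℝ} (hk : k ≠ 0)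
    (h : ∀ ψ, normalComp a (gradQuad q) ψ = k) : a = 1 := by
  have h1 : ∀ ψ, (2 * q.2.1 * Real.cos ψ ^ 2 + 2 * q.2.2 * Real.sin ψ ^ 2) ^ 2
      = k ^ 2 * (a ^ 2 * Real.sin ψ ^ 2 + Real.cos ψ ^ 2 / a ^ 2) := by
    intro ψ
    have e := normalComp_mul_speed ha (gradQuad q) ψ
    rw [h ψ] at e
    rw [← speed_sq, ← mul_pow, e]
    simp only [gradQuad, bdry]
    field_simp
  have e0 := h1 0
  have e1 := h1 (Real.pi / 2)
  have e2 := h1 (Real.pi / 4)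
  simp only [Real.cos_zero, Real.sin_zero, Real.cos_pi_div_two, Real.sin_pi_div_two,
    Real.cos_pi_div_four, Real.sin_pi_div_four, div_pow, Real.sq_sqrt (zero_le_two (α := ℝ))] at e0 e1 e2
  -- At $\psi=\pi/4$ the value of $s^2$ is the average of its values at $0$ and $\pi/2$. With
  -- $X=2c_{xx}$, $Y=2c_{yy}$ this reads $((X+Y)/2)^2=(X^2+Y^2)/2$, so $X=Y$; then $s^2$ agrees at
  -- $0$ and $\pi/2$, giving $a^2=a^{-2}$.
  have hxy : (2 * q.2.1 - 2 * q.2.2) ^ 2 = 0 := by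
    linear_combination 2 * e0 + 2 * e1 - 4 * e2
  have hx : 2 * q.2.1 = 2 * q.2.2 := by
    rwa [pow_eq_zero_iff two_ne_zero, sub_eq_zero] at hxy
  have h2 : k ^ 2 * (a ^ 2 - 1 / a ^ 2) = 0 := by
    rw [hx] at e0
    linear_combination e0 - e1
  have h3 : a ^ 2 - 1 / a ^ 2 = 0 := (mul_eq_zero.1 h2).resolve_left (pow_ne_zero 2 hk)
  field_simp at h3
  have h4 : a ^ 4 = 1 := by linarith
  exact (pow_eq_one_iff_of_nonneg ha.le (by norm_num)).1 h4

lemma sigmaAInf_le (ha : 0 < a) {u : ℝ × ℝ → ℝ} (hu : SolvesInfinity a u) :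
    sigmaAInf a ≤ ∫ p in ellipse a, u p ∧
      (a ≠ 1 → sigmaAInf a < ∫ p in ellipse a, u p) := by
  have hv : IsC2C1 a (vStar a) (gradQuad (quadOf a 1 (tStar a) 0)) := by
    rw [vStar, testFun_eq_vQuad ha]
    exact isC2C1_vQuad a _
  obtain ⟨h1, h2⟩ := functionalA_of_solvesInfinity ha hu hv (bdryIntegral_testFun ha _)
  rw [← sigmaAInf_eq_functionalA ha] at h1 h2
  refine ⟨h1, fun hne => lt_of_le_of_ne h1 fun he => hne ?_⟩
  refine eq_one_of_normalComp_gradQuad_const ha ?_ (h2 he)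
  rw [area_eq_pi ha]
  have := perimeter_pos ha
  exact neg_ne_zero.2 (by positivity)

end EllipseSlip

theorem mainTheorem2 (a : ℝ) (ha : 1 ≤ a) :
    -- geometry of the ellipse
    EllipseSlip.area a = Real.pi ∧
    EllipseSlip.perimeter a = 4 * a * EllipseSlip.ellipticE (EllipseSlip.ecc a) ∧
    EllipseSlip.bdryMoment 1 a =
      4 / (3 * a) * ((1 + a ^ 4) * EllipseSlip.ellipticE (EllipseSlip.ecc a)
        + EllipseSlip.ellipticK (EllipseSlip.ecc a)) ∧
    EllipseSlip.bdryMoment 2 a =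
      4 / (5 * a ^ 3) * ((1 - a ^ 4 + a ^ 8) * EllipseSlip.ellipticE (EllipseSlip.ecc a)
        + 2 * (1 + a ^ 4) * EllipseSlip.ellipticK (EllipseSlip.ecc a)) ∧
    (1 < a →
      EllipseSlip.momentC1 a =
        (-2 * a ^ 2 * EllipseSlip.perimeter a + (1 + a ^ 4) * EllipseSlip.bdryMoment 1 a)
          / (-1 + a ^ 4) ∧
      EllipseSlip.momentC2 a =
        (4 * a ^ 4 * EllipseSlip.perimeter a
          - 4 * a ^ 2 * (1 + a ^ 4) * EllipseSlip.bdryMoment 1 a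
          + (1 + a ^ 4) ^ 2 * EllipseSlip.bdryMoment 2 a) / (-1 + a ^ 4) ^ 2) ∧
    -- the torsion function and the torsional rigidity
    EllipseSlip.SolvesSlip a 0 (EllipseSlip.u0 a) ∧
    EllipseSlip.torsionalRigidity a = Real.pi * a ^ 2 / (4 * (1 + a ^ 4)) ∧
    -- the test functions `u₀ + t (x² - y² - C₁ / P)` and the optimal one
    (∀ t : ℝ, EllipseSlip.bdryIntegral a (EllipseSlip.testFun a t) = 0) ∧
    (∀ t : ℝ, EllipseSlip.functionalA a (EllipseSlip.testFun a t) =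
      -(Real.pi * (4 * (1 + a ^ 4) ^ 2 * t ^ 2
        - 2 * (1 + a ^ 4)
          * (-1 + a ^ 4 - 4 * a ^ 2 * (EllipseSlip.momentC1 a / EllipseSlip.perimeter a)) * t
        - a ^ 4)) / (4 * a ^ 2 * (1 + a ^ 4))) ∧
    (∀ t : ℝ, t ≠ EllipseSlip.tStar a →
      EllipseSlip.functionalA a (EllipseSlip.testFun a t)
        < EllipseSlip.functionalA a (EllipseSlip.vStar a)) ∧
    -- the approximation to `Σ_∞`
    EllipseSlip.sigmaAInf a = EllipseSlip.functionalA a (EllipseSlip.vStar a) ∧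
    EllipseSlip.sigmaAInf a
      = ∫ p in EllipseSlip.ellipse a, EllipseSlip.gradSq (EllipseSlip.vStar a) p ∧
    EllipseSlip.sigmaAInf a =
      Real.pi * (a ^ 4 + 1 / 4 * (-1 + a ^ 4
        - 4 * a ^ 2 * (EllipseSlip.momentC1 a / EllipseSlip.perimeter a)) ^ 2)
        / (4 * a ^ 2 * (1 + a ^ 4)) ∧
    -- the approximation to `Σ₁`
    (∀ t : ℝ, EllipseSlip.functionalB a (EllipseSlip.testFun a t) =
      t ^ 2 * (EllipseSlip.momentC2 a - EllipseSlip.momentC1 a ^ 2 / EllipseSlip.perimeter a)) ∧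
    EllipseSlip.sigmaAOne a =
      -((-4 * a ^ 2 * (EllipseSlip.momentC1 a / EllipseSlip.perimeter a) + a ^ 4 - 1) ^ 2
        * (EllipseSlip.momentC2 a - EllipseSlip.momentC1 a ^ 2 / EllipseSlip.perimeter a)
        / (16 * (a ^ 4 + 1) ^ 2)) ∧
    -- `R_a(β)` is the value of `𝒥` at the best quadratic and a lower bound for `Q(β)`
    (∀ β : ℝ, 0 < β →
      (1 < a → 0 < β * (EllipseSlip.sigmaAInf a - EllipseSlip.torsionalRigidity a)
        - EllipseSlip.sigmaAOne a) ∧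
      (∃! q : ℝ × ℝ × ℝ, EllipseSlip.IsBestQuad a β q) ∧
      (∀ q : ℝ × ℝ × ℝ, EllipseSlip.IsBestQuad a β q →
        EllipseSlip.functionalJ a β (EllipseSlip.vQuad q) = EllipseSlip.boundRa a β) ∧
      (∀ u : ℝ × ℝ → ℝ, EllipseSlip.SolvesSlip a β u →
        EllipseSlip.boundRa a β ≤ ∫ p in EllipseSlip.ellipse a, u p)) ∧
    -- `Σ_{a,∞} ≤ Σ_∞`, strictly unless the ellipse is a disk
    (∀ u : ℝ × ℝ → ℝ, EllipseSlip.SolvesInfinity a u →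
      EllipseSlip.sigmaAInf a ≤ ∫ p in EllipseSlip.ellipse a, u p ∧
      (1 < a → EllipseSlip.sigmaAInf a < ∫ p in EllipseSlip.ellipse a, u p)) := by
  have h0 : 0 < a := by linarith
  open EllipseSlip in
  refine ⟨area_eq_pi h0, perimeter_eq_ellipticE ha, ?_, ?_, fun h1 => ?_, solvesSlip_u0 h0,
    torsionalRigidity_eq h0, bdryIntegral_testFun h0, functionalA_testFun h0,
    fun t ht => functionalA_testFun_lt h0 ht, sigmaAInf_eq_functionalA h0,
    sigmaAInf_eq_setIntegral_gradSq h0, sigmaAInf_eq h0, functionalB_testFun h0,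
    sigmaAOne_eq h0, fun β hβ => ⟨fun h1 => boundRa_denominator_pos h1 hβ,
      ⟨_, (isBestQuad_iff h0 hβ _).2 rfl, fun q hq => (isBestQuad_iff h0 hβ q).1 hq⟩,
      fun q hq => functionalJ_of_isBestQuad h0 hβ hq, fun u hu => boundRa_le h0 hβ hu⟩,
    fun u hu => ⟨(sigmaAInf_le h0 hu).1, fun h1 => (sigmaAInf_le h0 hu).2 h1.ne'⟩⟩
  · rw [EllipseSlip.bdryMoment_one_eq h0, EllipseSlip.perimeter_eq_ellipticE ha,
      EllipseSlip.integral_inv_speed_eq_ellipticK ha]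
    field_simp
    ring
  · rw [EllipseSlip.bdryMoment_two_eq h0, EllipseSlip.perimeter_eq_ellipticE ha,
      EllipseSlip.integral_inv_speed_eq_ellipticK ha]
    field_simp
    ring
  · have h4 : (-1 + a ^ 4) ≠ 0 := by
      have := one_lt_pow₀ h1 (n := 4) (by norm_num)
      linarith
    constructor
    · rw [← EllipseSlip.momentC1_eq h0, mul_div_cancel_left₀ _ h4]
    · rw [← EllipseSlip.momentC2_eq h0, mul_div_cancel_left₀ _ (pow_ne_zero 2 h4)]
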